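/- Let $V$ be a multiset of $n\ge 1$ points (voters) on the real line, and let $k,\ell\ge 1$ be integers. In the one-round discrete Voronoi game $\langle V,k,\ell\rangle$, player $\mathcal P$ first chooses a set $P\subset\mathbb R$ with $|P|=k$, and then player $\mathcal Q$ chooses a set $Q\subset\mathbb R$ with $|Q|=\ell$. Let $V[P\succeq Q]:=\{v\in V:\min_{p\in P}|v-p|\le\min_{q\in Q}|v-q|\}$ be the multiset of voters won by $\mathcal P$, with size $|V[P\succeq Q]|$ counted with multiplicity, and let $$\Gamma_{k,\ell}(V):=\max_{P\subset\mathbb R,\ |P|=k}\ \min_{Q\subset\mathbb R,\ |Q|=\ell}\ \bigl|V[P\succeq Q]\bigr| .$$ A set $P$ with $|P|=k$ is a winning strategy for $\mathcal P$ if $|V[P\succeq Q]|\ge n/2$ for every $Q\subset\mathbb R$ with $|Q|=\ell$. Theorem. There is a single real-RAM algorithm which, given $n$, $k$, $\ell$ and the $n$ voters of $V$ in an arbitrary order, computes the value $\Gamma_{k,\ell}(V)$ together with a set $P\subset\mathbb R$, $|P|=k$, that attains it, that is, $|V[P\succeq Q]|\ge\Gamma_{k,\ell}(V)$ for every $Q\subset\mathbb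 R$ with $|Q|=\ell$; it also decides whether $\mathcal P$ has a winning strategy. Its running time is $O(k\,n^4)$: there is an absolute constant $C$ such that, for all inputs with $n,k,\ell\ge1$, it halts after at most $C\,k\,n^4$ steps. Here a real RAM is a random access machine with registers and arrays for natural numbers and for real numbers. Each elementary operation (setting a register to an integer constant, copying, adding, subtracting, reading or writing an array cell) and each comparison of two registers takes one step. Addition and subtraction are the only arithmetic operations that are used; there is no rounding operation. -/

import Mathlib

/-! ## The one-round discrete Voronoi game -/

namespace VoronoiGame

open Classical in
/-- The multiset `V[P ⪰ Q]` of voters won by the first player: a voter is won if its distance to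
`P` is at most its distance to `Q`.  For the nonempty finite sets `P`, `Q` played in the game,
`Metric.infDist` is the minimum distance. -/
noncomputable def won {E : Type*} [MetricSpace E] (V : Multiset E) (P Q : Finset E) : Multiset E :=
  V.filter fun v => Metric.infDist v (P : Set E) ≤ Metric.infDist v (Q : Set E)

/-- `Γ_{k,ℓ}(V)`: the maximum over sets `P` of `k` points of the minimum over sets `Q` of `ℓ`
points of the number of voters (with multiplicity) won by the first player. -/
noncomputable def Gam {E : Type*} [MetricSpace E] (k l : ℕ) (V : Multiset E) : ℕ :=
  ⨆ P : {P : Finset E // P.card = k}, ⨅ Q : {Q : Finset E // Q.card = l}, (won V P.1 Q.1).card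

/-- The strategy `P` realizes the gain `g` against all opponents that play `ℓ` points. -/
def Realizes {E : Type*} [MetricSpace E] (V : Multiset E) (l : ℕ) (P : Finset E) (g : ℕ) : Prop :=
  ∀ Q : Finset E, Q.card = l → g ≤ (won V P Q).card

/-- The first player has a winning strategy in the game `⟨V, k, ℓ⟩`: some set of `k` points wins
at least half of the voters against every set of `ℓ` points. -/
def HasWinningStrategy {E : Type*} [MetricSpace E] (V : Multiset E) (k l : ℕ) : Prop :=
  ∃ P : Finset E, P.card = k ∧
    ∀ Q : Finset E, Q.card = l → ((V.card : ℝ) / 2 ≤ ((won V P Q).card : ℝ))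

end VoronoiGame

/-! ## A real RAM with step count

A random access machine with registers and randomly accessible arrays, both for natural numbers and
for real numbers.  One elementary operation or one test takes one step.  The only arithmetic is
addition and subtraction, the only constants are integers, and there is no conversion between
reals and naturals (in particular no rounding).  Control flow is structured. -/

namespace RealRAM

/-- A memory state. -/
structure Store where
  /-- natural number registers -/
  nat : ℕ → ℕ
  /-- real registers -/
  real : ℕ → ℝ
  /-- natural number arrays: `natMem a i` is cell `i` of array `a` -/
  natMem : ℕ → ℕ → ℕ
  /-- real arrays: `realMem a i` is cell `i` of array `a` -/
  realMem : ℕ → ℕ → ℝ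

/-- Elementary operations; `x y z` are register numbers and `a` is an array number. -/
inductive Op where
  /-- `x := c` -/
  | natConst (x c : ℕ)
  /-- `x := y` -/
  | natCopy (x y : ℕ)
  /-- `x := y + z` -/
  | natAdd (x y z : ℕ)
  /-- `x := y - z`, truncated at zero -/
  | natSub (x y z : ℕ)
  /-- `x := a[y]` -/
  | natLoad (x a y : ℕ)
  /-- `a[y] := x` -/
  | natStore (a y x : ℕ)
  /-- `x := c` -/
  | realConst (x : ℕ) (c : ℤ)
  /-- `x := y` -/
  | realCopy (x y : ℕ)
  /-- `x := y + z` -/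
  | realAdd (x y z : ℕ)
  /-- `x := y - z` -/
  | realSub (x y z : ℕ)
  /-- `x := a[y]`, where `y` is a natural number register -/
  | realLoad (x a y : ℕ)
  /-- `a[y] := x`, where `y` is a natural number register -/
  | realStore (a y x : ℕ)

/-- Effect of an elementary operation. -/
noncomputable def Op.exec : Op → Store → Store
  | .natConst x c, s => { s with nat := Function.update s.nat x c }
  | .natCopy x y, s => { s with nat := Function.update s.nat x (s.nat y) }
  | .natAdd x y z, s => { s with nat := Function.update s.nat x (s.nat y + s.nat z) }
  | .natSub x y z, s => { s with nat := Function.update s.nat x (s.nat y - s.nat z) }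
  | .natLoad x a y, s => { s with nat := Function.update s.nat x (s.natMem a (s.nat y)) }
  | .natStore a y x, s =>
      { s with
        natMem := Function.update s.natMem a
          (Function.update (s.natMem a) (s.nat y) (s.nat x)) }
  | .realConst x c, s => { s with real := Function.update s.real x (c : ℝ) }
  | .realCopy x y, s => { s with real := Function.update s.real x (s.real y) }
  | .realAdd x y z, s => { s with real := Function.update s.real x (s.real y + s.real z) }
  | .realSub x y z, s => { s with real := Function.update s.real x (s.real y - s.real z) }
  | .realLoad x a y, s => { s with real := Function.update s.real x (s.realMem a (s.nat y)) }
  | .realStore a y x, s =>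
      { s with
        realMem := Function.update s.realMem a
          (Function.update (s.realMem a) (s.nat y) (s.real x)) }

/-- Elementary tests: comparisons of two registers. -/
inductive Test where
  | natLe (x y : ℕ)
  | natLt (x y : ℕ)
  | realLe (x y : ℕ)
  | realLt (x y : ℕ)

/-- The truth value of a test. -/
def Test.holds : Test → Store → Prop
  | .natLe x y, s => s.nat x ≤ s.nat y
  | .natLt x y, s => s.nat x < s.nat y
  | .realLe x y, s => s.real x ≤ s.real y
  | .realLt x y, s => s.real x < s.real y

/-- Programs. -/
inductive Program where
  /-- do nothing -/
  | skip
  /-- an elementary operation -/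
  | op (o : Op)
  /-- `p; q` -/
  | seq (p q : Program)
  /-- `if b then p else q` -/
  | branch (b : Test) (p q : Program)
  /-- `while b do p` -/
  | loop (b : Test) (p : Program)

/-- `Runs p s t s'`: started in the state `s`, the program `p` halts after exactly `t` steps in the
state `s'`.  Each elementary operation, each evaluation of a test and each `skip` is one step. -/
inductive Runs : Program → Store → ℕ → Store → Prop where
  | skip (s : Store) : Runs .skip s 1 s
  | op (o : Op) (s : Store) : Runs (.op o) s 1 (o.exec s)
  | seq {p q : Program} {s₁ s₂ s₃ : Store} {t₁ t₂ : ℕ} (h₁ : Runs p s₁ t₁ s₂)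
      (h₂ : Runs q s₂ t₂ s₃) : Runs (.seq p q) s₁ (t₁ + t₂) s₃
  | branchTrue {b : Test} {p q : Program} {s₁ s₂ : Store} {t : ℕ} (hb : b.holds s₁)
      (h : Runs p s₁ t s₂) : Runs (.branch b p q) s₁ (1 + t) s₂
  | branchFalse {b : Test} {p q : Program} {s₁ s₂ : Store} {t : ℕ} (hb : ¬ b.holds s₁)
      (h : Runs q s₁ t s₂) : Runs (.branch b p q) s₁ (1 + t) s₂
  | loopTrue {b : Test} {p : Program} {s₁ s₂ s₃ : Store} {t₁ t₂ : ℕ} (hb : b.holds s₁)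
      (h₁ : Runs p s₁ t₁ s₂) (h₂ : Runs (.loop b p) s₂ t₂ s₃) :
      Runs (.loop b p) s₁ (1 + t₁ + t₂) s₃
  | loopFalse {b : Test} {p : Program} {s : Store} (hb : ¬ b.holds s) : Runs (.loop b p) s 1 s

/-- The machine is deterministic, so the final state and the number of steps are determined by the
program and the initial state. -/
theorem Runs.deterministic {p : Program} {s s₁ s₂ : Store} {t₁ t₂ : ℕ}
    (h₁ : Runs p s t₁ s₁) (h₂ : Runs p s t₂ s₂) : t₁ = t₂ ∧ s₁ = s₂ := by
  induction h₁ generalizing t₂ s₂ with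
  | skip s => cases h₂; exact ⟨rfl, rfl⟩
  | op o s => cases h₂; exact ⟨rfl, rfl⟩
  | seq _ _ ih₁ ih₂ =>
    cases h₂ with
    | seq g₁ g₂ =>
      obtain ⟨rfl, rfl⟩ := ih₁ g₁
      obtain ⟨rfl, rfl⟩ := ih₂ g₂
      exact ⟨rfl, rfl⟩
  | branchTrue hb _ ih =>
    cases h₂ with
    | branchTrue _ g => obtain ⟨rfl, rfl⟩ := ih g; exact ⟨rfl, rfl⟩
    | branchFalse hb' _ => exact absurd hb hb'
  | branchFalse hb _ ih =>
    cases h₂ with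
    | branchTrue hb' _ => exact absurd hb' hb
    | branchFalse _ g => obtain ⟨rfl, rfl⟩ := ih g; exact ⟨rfl, rfl⟩
  | loopTrue hb _ _ ih₁ ih₂ =>
    cases h₂ with
    | loopTrue _ g₁ g₂ =>
      obtain ⟨rfl, rfl⟩ := ih₁ g₁
      obtain ⟨rfl, rfl⟩ := ih₂ g₂
      exact ⟨rfl, rfl⟩
    | loopFalse hb' => exact absurd hb hb'
  | loopFalse hb =>
    cases h₂ with
    | loopTrue hb' _ _ => exact absurd hb' hb
    | loopFalse _ => exact ⟨rfl, rfl⟩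

end RealRAM

namespace VoronoiGame

/-- The input of a game on the line: natural number registers `0, 1, 2` hold the number of voters,
`k` and `ℓ`, real array `0` holds the voters (in the arbitrary order of the list), and all other
memory is zero. -/
noncomputable def input (V : List ℝ) (k l : ℕ) : RealRAM.Store where
  nat x := if x = 0 then V.length else if x = 1 then k else if x = 2 then l else 0
  real _ := 0
  natMem _ _ := 0
  realMem a i := if a = 0 then V.getD i 0 else 0

/-- The value that the machine outputs: natural number register `0`. -/
def outputValue (s : RealRAM.Store) : ℕ := s.nat 0

/-- The answer `1` (yes) or `0` (no) that the machine outputs: natural number register `1`. -/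
def outputAnswer (s : RealRAM.Store) : ℕ := s.nat 1

/-- The set of points that the machine outputs: the first `k` cells of real array `1`. -/
noncomputable def outputStrategy (k : ℕ) (s : RealRAM.Store) : Finset ℝ :=
  (Finset.range k).image fun i => s.realMem 1 i

end VoronoiGame

/-! It suffices to minimize the number of voters that the second player wins. Add far ends p_0 and
p_{k+1} to the points p_1 < ... < p_k. A point of Q wins only voters of the gap that contains it. In
a gap (p, p'), one point can win g_1 voters, the size of a largest block of voters inside the gap
that spans less than half of its length; two points, placed at the extreme voters, win all g_2
voters of the gap. A block inside the gap can be cut into two parts, one of which spans less than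
half the gap, so g_2 ≤ 2 g_1 (`gainTwo_le_two_mul`). The marginal gains g_1 and g_2 - g_1 are thus
decreasing, and a best reply collects the ℓ largest marginal gains over all gaps.

The sum of the ℓ largest numbers G_i is the minimum over t of ℓ t + ∑ (G_i - t)^+. Hence the optimal
loss is the minimum of ℓ t + ∑ d_i over all thresholds t and budgets d_i for which gap i satisfies
g_1 ≤ t + d_i and g_2 ≤ 2t + d_i, which is `Step`. That such a pair bounds the loss is
`card_lost_le`; that every P loses as much as some such pair is `exists_step_le_card_lost`.

For fixed t, `Step` only bounds p' from above, and the bounds weaken as p moves right. So a dynamic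
program need only store the rightmost j-th point reachable with total budget c (`le_nextPoint_iff`,
`min_le_nextPoint`). Thresholds and budgets up to n suffice because the loss is at most n. With n +
1 thresholds, k + 1 rows, n + 1 budgets, at most n + 1 predecessors per entry and O(n) steps per
predecessor, the time is O(k n^4). The products ℓ t and the row offsets are maintained by repeated
addition. -/

namespace RealRAM

/-! ### Locations written by a program -/

/-- Whether the operation writes the natural number register `r`. -/
def Op.writesNat : Op → ℕ → Bool
  | .natConst x _, r | .natCopy x _, r | .natAdd x _ _, r | .natSub x _ _, r
  | .natLoad x _ _, r => x == r
  | _, _ => false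

/-- Whether the operation writes the real register `r`. -/
def Op.writesReal : Op → ℕ → Bool
  | .realConst x _, r | .realCopy x _, r | .realAdd x _ _, r | .realSub x _ _, r
  | .realLoad x _ _, r => x == r
  | _, _ => false

/-- Whether the operation writes the natural number array `r`. -/
def Op.writesNatMem : Op → ℕ → Bool
  | .natStore a _ _, r => a == r
  | _, _ => false

/-- Whether the operation writes the real array `r`. -/
def Op.writesRealMem : Op → ℕ → Bool
  | .realStore a _ _, r => a == r
  | _, _ => false

/-- Whether some operation that occurs in the program satisfies `f`. -/
def Program.anyOp (f : Op → Bool) : Program → Bool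
  | .skip => false
  | .op o => f o
  | .seq p q => p.anyOp f || q.anyOp f
  | .branch _ p q => p.anyOp f || q.anyOp f
  | .loop _ p => p.anyOp f

/-- `s` and `s'` agree at all locations that `p` does not write. -/
structure Frame (p : Program) (s s' : Store) : Prop where
  nat (r : ℕ) : p.anyOp (·.writesNat r) = false → s'.nat r = s.nat r
  real (r : ℕ) : p.anyOp (·.writesReal r) = false → s'.real r = s.real r
  natMem (a : ℕ) : p.anyOp (·.writesNatMem a) = false → s'.natMem a = s.natMem a
  realMem (a : ℕ) : p.anyOp (·.writesRealMem a) = false → s'.realMem a = s.realMem a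

theorem Frame.refl (p : Program) (s : Store) : Frame p s s :=
  ⟨fun _ _ => rfl, fun _ _ => rfl, fun _ _ => rfl, fun _ _ => rfl⟩

theorem Frame.trans {p : Program} {s₁ s₂ s₃ : Store} (h : Frame p s₁ s₂) (g : Frame p s₂ s₃) :
    Frame p s₁ s₃ :=
  ⟨fun r hr => (g.nat r hr).trans (h.nat r hr), fun r hr => (g.real r hr).trans (h.real r hr),
    fun r hr => (g.natMem r hr).trans (h.natMem r hr),
    fun r hr => (g.realMem r hr).trans (h.realMem r hr)⟩

theorem Frame.mono {p q : Program} {s s' : Store} (h : Frame p s s')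
    (hpq : ∀ f, q.anyOp f = false → p.anyOp f = false) : Frame q s s' :=
  ⟨fun r hr => h.nat r (hpq _ hr), fun r hr => h.real r (hpq _ hr),
    fun r hr => h.natMem r (hpq _ hr), fun r hr => h.realMem r (hpq _ hr)⟩

theorem Frame.exec (o : Op) (s : Store) : Frame (.op o) s (o.exec s) := by
  constructor <;> intro r hr <;> cases o <;>
    simp_all [Program.anyOp, Op.writesNat, Op.writesReal, Op.writesNatMem, Op.writesRealMem,
      Op.exec] <;> exact Function.update_of_ne (fun h => hr h.symm) _ _

/-- Specifications can thereby speak only of what a program changes: the rest follows from a Boolean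
computation on the program text, closed by `rfl` at each use. -/
theorem Runs.frame {p : Program} {s s' : Store} {t : ℕ} (h : Runs p s t s') : Frame p s s' := by
  induction h with
  | skip s => exact .refl _ _
  | op o s => exact .exec o s
  | seq _ _ ih₁ ih₂ =>
    refine (ih₁.mono ?_).trans (ih₂.mono ?_) <;> intro f hf <;> simp_all [Program.anyOp]
  | branchTrue _ _ ih => refine ih.mono ?_; intro f hf; simp_all [Program.anyOp]
  | branchFalse _ _ ih => refine ih.mono ?_; intro f hf; simp_all [Program.anyOp]
  | loopTrue _ _ _ ih₁ ih₂ => exact (ih₁.mono fun f hf => by simpa [Program.anyOp]).trans ih₂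
  | loopFalse _ => exact .refl _ _

/-! ### Total correctness with a time bound -/

/-- Started in `s`, the program halts after at most `T` steps in a state that satisfies `Q`. -/
def Ends (p : Program) (T : ℕ) (Q : Store → Prop) (s : Store) : Prop :=
  ∃ t s', Runs p s t s' ∧ t ≤ T ∧ Q s'

theorem Ends.mono {p : Program} {T T' : ℕ} {Q Q' : Store → Prop} {s : Store} (h : Ends p T Q s)
    (hT : T ≤ T') (hQ : ∀ s', Frame p s s' → Q s' → Q' s') : Ends p T' Q' s := by
  obtain ⟨t, s', hr, ht, hq⟩ := h
  exact ⟨t, s', hr, ht.trans hT, hQ s' hr.frame hq⟩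

theorem Ends.le {p : Program} {T T' : ℕ} {Q : Store → Prop} {s : Store} (h : Ends p T Q s)
    (hT : T ≤ T') : Ends p T' Q s := h.mono hT fun _ _ h => h

theorem Ends.of_skip {Q : Store → Prop} {s : Store} (h : Q s) : Ends .skip 1 Q s :=
  ⟨1, s, .skip s, le_rfl, h⟩

theorem Ends.seq {p q : Program} {T₁ T₂ : ℕ} {Q : Store → Prop} {s : Store}
    (h : Ends p T₁ (Ends q T₂ Q) s) : Ends (.seq p q) (T₁ + T₂) Q s := by
  obtain ⟨t, s', hr, ht, t', s'', hr', ht', hq⟩ := h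
  exact ⟨t + t', s'', .seq hr hr', by omega, hq⟩

theorem Ends.seq_of {p q : Program} {T₁ T₂ : ℕ} {Q₁ Q : Store → Prop} {s : Store}
    (h : Ends p T₁ Q₁ s) (h' : ∀ s', Frame p s s' → Q₁ s' → Ends q T₂ Q s') :
    Ends (.seq p q) (T₁ + T₂) Q s :=
  .seq (h.mono le_rfl h')

/-- Adding the bounds of both branches, instead of taking a maximum, keeps time bounds simple sums;
in every branch used below at least one side has constant cost. -/
theorem Ends.branch {b : Test} {p q : Program} {T₁ T₂ : ℕ} {Q : Store → Prop} {s : Store}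
    (h₁ : b.holds s → Ends p T₁ Q s) (h₂ : ¬ b.holds s → Ends q T₂ Q s) :
    Ends (.branch b p q) (T₁ + T₂ + 1) Q s := by
  by_cases hb : b.holds s
  · obtain ⟨t, s', hr, ht, hq⟩ := h₁ hb
    exact ⟨1 + t, s', .branchTrue hb hr, by omega, hq⟩
  · obtain ⟨t, s', hr, ht, hq⟩ := h₂ hb
    exact ⟨1 + t, s', .branchFalse hb hr, by omega, hq⟩

/-- Straight-line programs. -/
def ops : List Op → Program
  | [] => .skip
  | o :: l => .seq (.op o) (ops l)

/-- The effect of a sequence of operations. -/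
noncomputable def execs : List Op → Store → Store
  | [], s => s
  | o :: l, s => execs l (o.exec s)

theorem Ends.of_ops {l : List Op} {Q : Store → Prop} {s : Store} (h : Q (execs l s)) :
    Ends (ops l) (l.length + 1) Q s := by
  induction l generalizing s with
  | nil => exact .of_skip h
  | cons o l ih =>
    obtain ⟨t, s', hr, ht, hq⟩ := ih h
    exact ⟨1 + t, s', .seq (.op o s) hr, by simp; omega, hq⟩

/-- Straight-line code followed by a program. -/
theorem Ends.ops_seq {l : List Op} {q : Program} {T : ℕ} {Q : Store → Prop} {s : Store}
    (h : Ends q T Q (execs l s)) : Ends (.seq (ops l) q) (l.length + 1 + T) Q s :=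
  .seq (.of_ops h)

/-- `x := min x y` for real registers. -/
def minInto (x y : ℕ) : Program := .branch (.realLt y x) (ops [.realCopy x y]) .skip

/-- `x := max x y` for real registers. -/
def maxInto (x y : ℕ) : Program := .branch (.realLt x y) (ops [.realCopy x y]) .skip

theorem Ends.of_minInto {x y : ℕ} {Q : Store → Prop} {s : Store}
    (h : Q { s with real := Function.update s.real x (min (s.real x) (s.real y)) }) :
    Ends (minInto x y) 4 Q s := by
  refine .branch (fun hb => .of_ops ?_) fun hb => .of_skip ?_ <;> simp only [Test.holds] at hb
  · rwa [min_eq_right hb.le] at h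
  · rwa [min_eq_left (not_lt.1 hb), Function.update_eq_self] at h

theorem Ends.of_maxInto {x y : ℕ} {Q : Store → Prop} {s : Store}
    (h : Q { s with real := Function.update s.real x (max (s.real x) (s.real y)) }) :
    Ends (maxInto x y) 4 Q s := by
  refine .branch (fun hb => .of_ops ?_) fun hb => .of_skip ?_ <;> simp only [Test.holds] at hb
  · rwa [max_eq_right hb.le] at h
  · rwa [max_eq_left (not_lt.1 hb), Function.update_eq_self] at h

/-- `for x := 0 to y - 1 do p`, where register `o` holds the number one. -/
def forLoop (o x y : ℕ) (p : Program) : Program :=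
  .seq (.op (.natConst x 0)) (.loop (.natLt x y) (.seq p (.op (.natAdd x x o))))

/-- The state with the natural number register `x` set to `c`. -/
def Store.setNat (s : Store) (x c : ℕ) : Store := { s with nat := Function.update s.nat x c }

/-- The rule for `forLoop`.  The invariant need not mention what the loop does not write. -/
theorem Ends.forLoop {o x y : ℕ} {p : Program} {N T : ℕ} {s₀ : Store} (I : ℕ → Store → Prop)
    (hxy : x ≠ y) (hxo : x ≠ o) (hx : p.anyOp (·.writesNat x) = false)
    (hy : p.anyOp (·.writesNat y) = false) (ho : p.anyOp (·.writesNat o) = false)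
    (hN : s₀.nat y = N) (h1 : s₀.nat o = 1) (h0 : I 0 (s₀.setNat x 0))
    (hI : ∀ i s, i < N → Frame (forLoop o x y p) s₀ s → s.nat x = i → I i s →
      Ends p T (fun s' => I (i + 1) (s'.setNat x (i + 1))) s) :
    Ends (forLoop o x y p) (N * (T + 2) + 2) (fun s => s.nat x = N ∧ I N s) s₀ := by
  have hw : ∀ {f : Op → Bool}, (RealRAM.forLoop o x y p).anyOp f = false →
      f (.natConst x 0) = false ∧ p.anyOp f = false ∧ f (.natAdd x x o) = false := by
    intro f hf
    simpa [RealRAM.forLoop, Program.anyOp] using hf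
  have hne : ∀ {r : ℕ}, (RealRAM.forLoop o x y p).anyOp (·.writesNat r) = false → r ≠ x := by
    rintro r hr rfl
    simpa [Op.writesNat] using (hw hr).1
  have hset : ∀ (s : Store) (c : ℕ), Frame (RealRAM.forLoop o x y p) s (s.setNat x c) := fun s c =>
    ⟨fun r hr => Function.update_of_ne (hne hr) _ _, fun _ _ => rfl, fun _ _ => rfl,
      fun _ _ => rfl⟩
  have fr : ∀ {f : ℕ}, f ≠ x → p.anyOp (·.writesNat f) = false →
      (RealRAM.forLoop o x y p).anyOp (·.writesNat f) = false := by
    intro f hf hpf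
    have h : (x == f) = false := by simpa using hf.symm
    change (_ || (_ || _)) = false
    rw [hpf]
    simp [Program.anyOp, Op.writesNat, h]
  -- Induction on the number `m` of remaining rounds.
  have main : ∀ m i s, i + m = N → Frame (RealRAM.forLoop o x y p) s₀ s → s.nat x = i → I i s →
      Ends (.loop (.natLt x y) (.seq p (.op (.natAdd x x o)))) (m * (T + 2) + 1)
        (fun s => s.nat x = N ∧ I N s) s := by
    intro m
    induction m with
    | zero =>
      intro i s hi hf hx hIs
      obtain rfl : i = N := by omega
      refine ⟨1, s, .loopFalse ?_, by omega, hx, hIs⟩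
      have := hf.nat y (fr hxy.symm hy)
      simp [Test.holds]; omega
    | succ m ih =>
      intro i s hi hf hxi hIs
      obtain ⟨t, s', hr, ht, hq⟩ := hI i s (by omega) hf hxi hIs
      have hfy := hf.nat y (fr hxy.symm hy)
      have hfo := hf.nat o (fr hxo.symm ho)
      have e : (Op.natAdd x x o).exec s' = s'.setNat x (i + 1) := by
        have := hr.frame.nat x hx
        have := hr.frame.nat o ho
        simp only [Op.exec, Store.setNat]
        congr 2
        omega
      have hfr : Frame (RealRAM.forLoop o x y p) s s' := hr.frame.mono fun f hf => (hw hf).2.1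
      obtain ⟨t', s'', hr', ht', hq'⟩ := ih (i + 1) (s'.setNat x (i + 1)) (by omega)
        ((hf.trans hfr).trans (hset _ _)) (by simp [Store.setNat]) hq
      refine ⟨1 + (t + 1) + t', s'', .loopTrue ?_ (.seq hr (e ▸ .op _ _)) hr', ?_, hq'⟩
      · simp [Test.holds]; omega
      · have : (m + 1) * (T + 2) = m * (T + 2) + (T + 2) := by ring
        omega
  obtain ⟨t, s', hr, ht, hq⟩ := main N 0 (s₀.setNat x 0) (by omega) (hset _ _)
    (by simp [Store.setNat]) h0
  exact ⟨1 + t, s', .seq (.op _ _) hr, by omega, hq⟩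

end RealRAM

namespace VoronoiGame

/-! ### Gaps between consecutive points of the first player -/

/-- `v 0 ≤ v 1 ≤ ⋯ ≤ v (n - 1)`. -/
def SortedBelow (v : ℕ → ℝ) (n : ℕ) : Prop := ∀ i j, i ≤ j → j < n → v i ≤ v j

/-- A point far to the left of the voters. -/
noncomputable def leftEnd (v : ℕ → ℝ) (n : ℕ) : ℝ :=
  v 0 - (v (n - 1) - v 0) - (v (n - 1) - v 0) - 1

/-- A point far to the right of the voters. -/
noncomputable def rightEnd (v : ℕ → ℝ) (n : ℕ) : ℝ :=
  v (n - 1) + (v (n - 1) - v 0) + (v (n - 1) - v 0) + 1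

/-- A single point between `p` and `p'` wins at most `m` voters there. -/
def OneWins (v : ℕ → ℝ) (n m : ℕ) (p p' : ℝ) : Prop :=
  ∀ a, p < v a → a + m < n → p' ≤ max (v (a + m)) (p + (v (a + m) - v a + (v (a + m) - v a)))

/-- There are at most `m` voters between `p` and `p'`. -/
def TwoWin (v : ℕ → ℝ) (n m : ℕ) (p p' : ℝ) : Prop :=
  ∀ a, p < v a → a + m < n → p' ≤ v (a + m)

/-- In the gap between `p` and `p'` the second player wins at most `d` voters more than `t` per
point. -/
def Step (v : ℕ → ℝ) (n t d : ℕ) (p p' : ℝ) : Prop :=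
  OneWins v n (t + d) p p' ∧ TwoWin v n (t + d + t) p p'

open Classical in
/-- The voters, as indices, won by the second player. -/
noncomputable def lost (v : ℕ → ℝ) (n : ℕ) (P Q : Finset ℝ) : Finset ℕ :=
  (Finset.range n).filter fun a => Metric.infDist (v a) (Q : Set ℝ) < Metric.infDist (v a) (P : Set ℝ)

theorem exists_infDist_eq {P : Finset ℝ} (hP : P.Nonempty) (x : ℝ) :
    ∃ y ∈ P, Metric.infDist x (P : Set ℝ) = |x - y| := by
  obtain ⟨y, hy, h⟩ := P.finite_toSet.isCompact.exists_infDist_eq_dist (by simpa using hP) x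
  exact ⟨y, by simpa using hy, by rw [h, Real.dist_eq]⟩

theorem infDist_le_abs {P : Finset ℝ} (x : ℝ) {y : ℝ} (hy : y ∈ P) :
    Metric.infDist x (P : Set ℝ) ≤ |x - y| := by
  rw [← Real.dist_eq]
  exact Metric.infDist_le_dist_of_mem (by simpa using hy)

/-- Ties go to the first player and the minimum distances are attained, so a lost voter has a single
witness in `Q` that beats all of `P` strictly. -/
theorem mem_lost {v : ℕ → ℝ} {n a : ℕ} {P Q : Finset ℝ} (hP : P.Nonempty) (hQ : Q.Nonempty) :
    a ∈ lost v n P Q ↔ a < n ∧ ∃ q ∈ Q, ∀ p ∈ P, |v a - q| < |v a - p| := by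
  simp only [lost, Finset.mem_filter, Finset.mem_range]
  refine and_congr_right fun _ => ⟨fun h => ?_, ?_⟩
  · obtain ⟨q, hq, e⟩ := exists_infDist_eq hQ (v a)
    exact ⟨q, hq, fun p hp => by linarith [infDist_le_abs (v a) hp]⟩
  · rintro ⟨q, hq, h⟩
    obtain ⟨p, hp, e⟩ := exists_infDist_eq hP (v a)
    linarith [infDist_le_abs (v a) hq, h p hp]

theorem card_won_add_card_lost (v : ℕ → ℝ) (n : ℕ) (P Q : Finset ℝ) :
    (won ((Multiset.range n).map v) P Q).card + (lost v n P Q).card = n := by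
  classical
  have h := Finset.card_filter_add_card_filter_not (s := Finset.range n)
    fun a => Metric.infDist (v a) (P : Set ℝ) ≤ Metric.infDist (v a) (Q : Set ℝ)
  simp only [not_le, Finset.card_range] at h
  refine Eq.trans ?_ h
  congr 1
  · simp only [won, Multiset.filter_map, Multiset.card_map]
    rfl

/-! ### An upper bound for the second player -/

/-- The points of a chain that the first player plays. -/
noncomputable def chainSet (p : ℕ → ℝ) (k : ℕ) : Finset ℝ := (Finset.Icc 1 k).image p

theorem mem_chainSet {p : ℕ → ℝ} {k j : ℕ} (h1 : 1 ≤ j) (hk : j ≤ k) : p j ∈ chainSet p k :=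
  Finset.mem_image_of_mem _ (Finset.mem_Icc.2 ⟨h1, hk⟩)

theorem card_le_max_sub_min {s : Finset ℕ} (hs : s.Nonempty) :
    s.min' hs + s.card ≤ s.max' hs + 1 := by
  have : s ⊆ Finset.Icc (s.min' hs) (s.max' hs) := fun x hx =>
    Finset.mem_Icc.2 ⟨s.min'_le x hx, s.le_max' x hx⟩
  have h := Finset.card_le_card this
  rw [Nat.card_Icc] at h
  have := s.min'_le _ (s.max'_mem hs)
  omega

/-- Sort both the lost voters and the points of `Q` by gap. A gap with r ≥ 1 points of `Q` loses at
most r t + d i voters, by `OneWins` if r = 1 and by `TwoWin` if r ≥ 2; a gap without points of `Q`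
loses none. -/
theorem card_lost_le {v : ℕ → ℝ} {n k t : ℕ} {p : ℕ → ℝ} {d : ℕ → ℕ} (hv : SortedBelow v n)
    (hk : 1 ≤ k) (hp0 : p 0 = leftEnd v n) (hpk : rightEnd v n ≤ p (k + 1))
    (hd : ∀ i ≤ k, Step v n t (d i) (p i) (p (i + 1))) {Q : Finset ℝ} (hQ : Q.Nonempty) :
    (lost v n (chainSet p k) Q).card ≤ Q.card * t + ∑ i ∈ Finset.range (k + 1), d i := by
  classical
  have hP : (chainSet p k).Nonempty := ⟨_, mem_chainSet le_rfl hk⟩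
  -- The gap of `x`: the last index in 1, ..., k whose point is at most `x`, and 0 if `x` is to the
  -- left of all played points.
  set g : ℝ → ℕ := fun x => Nat.findGreatest (fun j => p j ≤ x) k with hg
  have g_le : ∀ x, g x ≤ k := fun x => Nat.findGreatest_le k
  have g_spec : ∀ x, g x ≠ 0 → p (g x) ≤ x := fun x hx =>
    Nat.findGreatest_of_ne_zero (P := fun j => p j ≤ x) rfl hx
  have g_max : ∀ x j, g x < j → j ≤ k → x < p j := fun x j h1 h2 => not_le.1
    (Nat.findGreatest_is_greatest (P := fun j => p j ≤ x) h1 h2)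
  -- If a voter and `q` had different gaps, some played point would separate them, and it would be
  -- at least as close to the voter as `q`.
  have key : ∀ a q, (∀ x ∈ chainSet p k, |v a - q| < |v a - x|) → g q = g (v a) := by
    intro a q h
    rcases lt_trichotomy (g q) (g (v a)) with hlt | heq | hlt
    · have h1 := g_max q _ hlt (g_le _)
      have h2 := g_spec (v a) (by omega)
      have := h _ (mem_chainSet (by omega : 1 ≤ g (v a)) (g_le _))
      rw [abs_of_nonneg (by linarith), abs_of_nonneg (by linarith)] at this
      linarith
    · exact heq
    · have h1 := g_max (v a) _ hlt (g_le _)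
      have h2 := g_spec q (by omega)
      have := h _ (mem_chainSet (by omega : 1 ≤ g q) (g_le _))
      rw [abs_of_nonpos (by linarith), abs_of_nonpos (by linarith)] at this
      linarith
  have fiber : ∀ i ∈ Finset.range (k + 1),
      ((lost v n (chainSet p k) Q).filter (fun a => g (v a) = i)).card ≤
        (Q.filter (fun q => g q = i)).card * t + d i := by
    intro i hi
    have hik : i ≤ k := by simpa [Nat.lt_succ_iff] using hi
    set S := (lost v n (chainSet p k) Q).filter (fun a => g (v a) = i) with hS
    by_contra! hcon
    have hne : S.Nonempty := Finset.card_pos.1 (by omega)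
    have mS : ∀ a ∈ S, a < n ∧ g (v a) = i ∧ ∃ q ∈ Q.filter (fun q => g q = i),
        ∀ x ∈ chainSet p k, |v a - q| < |v a - x| := by
      intro a ha
      obtain ⟨ha, hga⟩ := Finset.mem_filter.1 ha
      obtain ⟨han, q, hq, h⟩ := (mem_lost hP hQ).1 ha
      exact ⟨han, hga, q, Finset.mem_filter.2 ⟨hq, (key a q h).trans hga⟩, h⟩
    have left : ∀ a ∈ S, p i < v a := by
      intro a ha
      obtain ⟨han, hga, q, -, h⟩ := mS a ha
      rcases Nat.eq_zero_or_pos i with rfl | hi0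
      · rw [hp0, leftEnd]
        linarith [hv 0 a (by omega) han, hv a (n - 1) (by omega) (by omega)]
      · have h1 := hga ▸ g_spec (v a) (by omega)
        refine lt_of_le_of_ne h1 fun e => ?_
        have := h _ (mem_chainSet hi0 hik)
        rw [e, sub_self, abs_zero] at this
        linarith [abs_nonneg (v a - q)]
    have right : ∀ a ∈ S, v a < p (i + 1) := by
      intro a ha
      obtain ⟨han, hga, -⟩ := mS a ha
      rcases hik.lt_or_eq with hlt | rfl
      · exact g_max _ _ (by omega) hlt
      · refine lt_of_lt_of_le ?_ hpk
        rw [rightEnd]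
        linarith [hv 0 a (by omega) han, hv a (n - 1) (by omega) (by omega)]
    set a := S.min' hne
    set b := S.max' hne
    have hab : a + S.card ≤ b + 1 := card_le_max_sub_min hne
    have ha : a ∈ S := S.min'_mem hne
    have hb : b ∈ S := S.max'_mem hne
    obtain ⟨han, hga, qa, hqa, hqa'⟩ := mS a ha
    obtain ⟨hbn, hgb, qb, hqb, hqb'⟩ := mS b hb
    have hcard : 1 ≤ (Q.filter (fun q => g q = i)).card := Finset.card_pos.2 ⟨qa, hqa⟩
    rcases hcard.lt_or_eq with h2 | h1
    · have : 2 * t ≤ (Q.filter (fun q => g q = i)).card * t := Nat.mul_le_mul_right _ h2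
      have := (hd i hik).2 a (left a ha) (by omega)
      have := hv (a + (t + d i + t)) b (by omega) hbn
      linarith [right b hb]
    · rw [← h1, one_mul] at hcon
      have hm := hv (a + (t + d i)) b (by omega) hbn
      have h3 := (hd i hik).1 a (left a ha) (by omega)
      rcases le_max_iff.1 h3 with h3 | h3
      · linarith [right b hb]
      -- In the two outer gaps the length condition cannot hold: the artificial ends are more than
      -- twice the span of the voters away from them.
      rcases Nat.eq_zero_or_pos i with rfl | hi0
      · rw [hp0, leftEnd] at h3
        linarith [right a ha, hv 0 a (by omega) han, hv b (n - 1) (by omega) (by omega)]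
      rcases hik.lt_or_eq with hlt | rfl
      -- The only point `q` of the gap wins both extreme voters, so 2 v b - p (i + 1) < q < 2 v a -
      -- p i, against the length condition `h3`.
      · obtain ⟨q, hq⟩ := Finset.card_eq_one.1 h1.symm
        rw [hq, Finset.mem_singleton] at hqa hqb
        subst hqa hqb
        have e1 := hqa' _ (mem_chainSet hi0 hik)
        have e2 := hqb' _ (mem_chainSet (by omega : 1 ≤ i + 1) hlt)
        rw [abs_of_pos (sub_pos.2 (left a ha))] at e1
        rw [abs_of_neg (sub_neg.2 (right b hb))] at e2
        linarith [abs_lt.1 e1, abs_lt.1 e2]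
      · rw [rightEnd] at hpk
        linarith [left a ha, hv 0 a (by omega) han, hv a (n - 1) (by omega) (by omega),
          hv b (n - 1) (by omega) (by omega)]
  have hmaps : ∀ x : ℝ, g x ∈ Finset.range (k + 1) := fun x =>
    Finset.mem_range.2 (Nat.lt_succ_of_le (g_le x))
  rw [Finset.card_eq_sum_card_fiberwise (f := fun a => g (v a)) (t := Finset.range (k + 1))
      fun a _ => hmaps _,
    Finset.card_eq_sum_card_fiberwise (f := g) (s := Q) (t := Finset.range (k + 1))
      fun a _ => hmaps _, Finset.sum_mul, ← Finset.sum_add_distrib]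
  exact Finset.sum_le_sum fiber

/-! ### A strategy for the second player -/

/-- Take the least `t` such that at most `l` of the numbers exceed `t`. If t > 0, more than `l` of
them are at least `t`, so there is a set `S` of exactly `l` indices that contains all with G > t and
only ones with G ≥ t. If t = 0, take all indices with positive `G`. -/
theorem exists_threshold {ι : Type*} (A : Finset ι) (G : ι → ℕ) (n l : ℕ)
    (hG : ∀ i ∈ A, G i ≤ n) :
    ∃ t ≤ n, ∃ S ⊆ A, S.card ≤ l ∧ l * t + ∑ i ∈ A, (G i - t) ≤ ∑ i ∈ S, G i := by
  classical
  have hn : (A.filter fun i => n < G i).card ≤ l := by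
    rw [Finset.filter_false_of_mem fun i hi => not_lt.2 (hG i hi)]
    simp
  have hex : ∃ t, (A.filter fun i => t < G i).card ≤ l := ⟨n, hn⟩
  refine ⟨Nat.find hex, Nat.find_min' hex hn, ?_⟩
  have hspec := Nat.find_spec hex
  rcases Nat.eq_zero_or_pos (Nat.find hex) with h0 | hpos
  · rw [h0] at hspec ⊢
    refine ⟨_, Finset.filter_subset _ _, hspec, ?_⟩
    rw [Finset.sum_filter]
    simp only [mul_zero, tsub_zero, zero_add]
    exact Finset.sum_le_sum fun i _ => by split <;> omega
  · have hmin := Nat.find_min hex (Nat.sub_lt hpos one_pos)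
    set t := Nat.find hex
    obtain ⟨S, h1, h2, h3⟩ := Finset.exists_subsuperset_card_eq
      (s := A.filter fun i => t < G i) (t := A.filter fun i => t - 1 < G i)
      (Finset.monotone_filter_right A fun i _ (h : t < G i) => (by omega : t - 1 < G i)) hspec
      (not_le.1 hmin).le
    have hSA : S ⊆ A := h2.trans (Finset.filter_subset _ _)
    refine ⟨S, hSA, h3.le, ?_⟩
    rw [← Finset.sum_subset hSA (f := fun i => G i - t) fun i hi hiS => ?_, ← h3,
      ← smul_eq_mul, ← Finset.sum_const, ← Finset.sum_add_distrib]
    · refine Finset.sum_le_sum fun i hi => ?_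
      have := (Finset.mem_filter.1 (h2 hi)).2
      omega
    · by_contra hne
      exact hiS (h1 (Finset.mem_filter.2 ⟨hi, by omega⟩))

/-! ### Gains within a single gap. -/

theorem OneWins.mono {v : ℕ → ℝ} {n m m' : ℕ} {p p' : ℝ} (hv : SortedBelow v n)
    (h : OneWins v n m p p') (hm : m ≤ m') : OneWins v n m' p p' := by
  intro a ha han
  have := hv (a + m) (a + m') (by omega) han
  exact (h a ha (by omega)).trans (max_le_max this (by linarith))

theorem TwoWin.mono {v : ℕ → ℝ} {n m m' : ℕ} {p p' : ℝ} (hv : SortedBelow v n)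
    (h : TwoWin v n m p p') (hm : m ≤ m') : TwoWin v n m' p p' := fun a ha han =>
  (h a ha (by omega)).trans (hv (a + m) (a + m') (by omega) han)

theorem exists_oneWins (v : ℕ → ℝ) (n : ℕ) (p p' : ℝ) : ∃ m, OneWins v n m p p' :=
  ⟨n, fun _ _ h => by omega⟩

theorem exists_twoWin (v : ℕ → ℝ) (n : ℕ) (p p' : ℝ) : ∃ m, TwoWin v n m p p' :=
  ⟨n, fun _ _ h => by omega⟩

open Classical in
/-- The number of voters between `p` and `p'` that one point can win. -/
noncomputable def gainOne (v : ℕ → ℝ) (n : ℕ) (p p' : ℝ) : ℕ := Nat.find (exists_oneWins v n p p')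

open Classical in
/-- The number of voters between `p` and `p'`. -/
noncomputable def gainTwo (v : ℕ → ℝ) (n : ℕ) (p p' : ℝ) : ℕ := Nat.find (exists_twoWin v n p p')

/-- The gain of the first point (`false`) and the additional gain of the second point (`true`) in
the gap between `p` and `p'`. -/
noncomputable def gain (v : ℕ → ℝ) (n : ℕ) (p p' : ℝ) : Bool → ℕ
  | false => gainOne v n p p'
  | true => gainTwo v n p p' - gainOne v n p p'

section Gap

variable {v : ℕ → ℝ} {n : ℕ} {p p' : ℝ}

theorem gainOne_le_gainTwo : gainOne v n p p' ≤ gainTwo v n p p' := by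
  classical
  refine Nat.find_min' _ fun a ha han => le_max_of_le_left ?_
  exact Nat.find_spec (exists_twoWin v n p p') a ha han

theorem gainTwo_le : gainTwo v n p p' ≤ n := by
  classical
  exact Nat.find_min' _ fun _ _ h => by omega

/-- Otherwise 2f + 1 consecutive voters, with f = `gainOne`, lie inside the gap. Both subblocks of f
+ 1 voters, which share the middle voter, must span at least half the gap, so together they span all
of it, which is impossible strictly inside. -/
theorem gainTwo_le_two_mul (hv : SortedBelow v n) :
    gainTwo v n p p' ≤ gainOne v n p p' + gainOne v n p p' := by
  classical
  refine Nat.find_min' _ fun a ha han => ?_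
  have h1 : OneWins v n (gainOne v n p p') p p' := Nat.find_spec (exists_oneWins v n p p')
  set f := gainOne v n p p'
  by_contra! hcon
  have m1 := hv a (a + f) (by omega) (by omega)
  have m2 := hv (a + f) (a + (f + f)) (by omega) (by omega)
  have e1 := h1 a ha (by omega)
  have e2 := h1 (a + f) (by linarith) (by omega)
  rw [add_assoc] at e2
  rcases le_max_iff.1 e1 with e1 | e1 <;> rcases le_max_iff.1 e2 with e2 | e2 <;> linarith

/-- The sum of the two truncated excesses dominates both g_1 - t and g_2 - 2t. -/
theorem step_of_gain (hv : SortedBelow v n) (t : ℕ) :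
    Step v n t (gain v n p p' false - t + (gain v n p p' true - t)) p p' := by
  classical
  have h1 : OneWins v n (gainOne v n p p') p p' := Nat.find_spec (exists_oneWins v n p p')
  have h2 : TwoWin v n (gainTwo v n p p') p p' := Nat.find_spec (exists_twoWin v n p p')
  simp only [gain]
  exact ⟨h1.mono hv (by omega), h2.mono hv (by omega)⟩

theorem exists_gainOne (hv : SortedBelow v n) : ∃ q, ∃ W ⊆ Finset.range n,
    W.card = gainOne v n p p' ∧ ∀ a ∈ W, p < v a ∧ v a < p' ∧ |v a - q| < v a - p ∧
      |v a - q| < p' - v a := by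
  classical
  rcases Nat.eq_zero_or_pos (gainOne v n p p') with h0 | hpos
  · exact ⟨0, ∅, by simp, by simp [h0], by simp⟩
  have hmin : ¬ OneWins v n (gainOne v n p p' - 1) p p' :=
    Nat.find_min (exists_oneWins v n p p') (Nat.sub_lt hpos one_pos)
  set f := gainOne v n p p'
  simp only [OneWins, not_forall, not_le, max_lt_iff] at hmin
  obtain ⟨a, ha, han, h1, h2⟩ := hmin
  set b := a + (f - 1)
  have hab := hv a b (by omega) han
  -- These bounds say exactly that `q` is inside the gap, nearer to `v a` than `p` is, and nearer to
  -- `v b` than `p'` is; the voters in between follow.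
  obtain ⟨q, hq1, hq2⟩ := exists_between
    (show max p (2 * v b - p') < min p' (2 * v a - p) from max_lt (lt_min (by linarith) (by linarith)) (lt_min (by linarith) (by linarith)))
  rw [max_lt_iff] at hq1
  rw [lt_min_iff] at hq2
  refine ⟨q, Finset.Icc a b, fun x hx => ?_, by simp; omega, fun x hx => ?_⟩
  · rw [Finset.mem_Icc] at hx
    exact Finset.mem_range.2 (by omega)
  · rw [Finset.mem_Icc] at hx
    have h3 := hv a x hx.1 (by omega)
    have h4 := hv x b hx.2 han
    refine ⟨by linarith, by linarith, abs_lt.2 ⟨by linarith, by linarith⟩,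
      abs_lt.2 ⟨by linarith, by linarith⟩⟩

/-- Put the two points on the first and the last voter of the block. A voter nearer to `p` is served
by the left one, a voter nearer to `p'` by the right one. -/
theorem exists_gainTwo (hv : SortedBelow v n) : ∃ Q : Finset ℝ, Q.card ≤ 2 ∧
    ∃ W ⊆ Finset.range n, W.card = gainTwo v n p p' ∧ ∀ a ∈ W, p < v a ∧ v a < p' ∧
      ∃ q ∈ Q, |v a - q| < v a - p ∧ |v a - q| < p' - v a := by
  classical
  rcases Nat.eq_zero_or_pos (gainTwo v n p p') with h0 | hpos
  · exact ⟨∅, by simp, ∅, by simp, by simp [h0], by simp⟩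
  have hmin : ¬ TwoWin v n (gainTwo v n p p' - 1) p p' :=
    Nat.find_min (exists_twoWin v n p p') (Nat.sub_lt hpos one_pos)
  set f := gainTwo v n p p'
  simp only [TwoWin, not_forall, not_le] at hmin
  obtain ⟨a, ha, han, h1⟩ := hmin
  set b := a + (f - 1)
  have hab := hv a b (by omega) han
  refine ⟨{v a, v b}, Finset.card_le_two, Finset.Icc a b, fun x hx => ?_, by simp; omega,
    fun x hx => ?_⟩
  · rw [Finset.mem_Icc] at hx
    exact Finset.mem_range.2 (by omega)
  · rw [Finset.mem_Icc] at hx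
    have h3 := hv a x hx.1 (by omega)
    have h4 := hv x b hx.2 han
    refine ⟨by linarith, by linarith, ?_⟩
    rcases le_total (v x - p) (p' - v x) with h | h
    · refine ⟨v a, by simp, ?_⟩
      rw [abs_of_nonneg (by linarith)]
      constructor <;> linarith
    · refine ⟨v b, by simp, ?_⟩
      rw [abs_of_nonpos (by linarith)]
      constructor <;> linarith

/-- A selection of marginal gains may contain the second gain of a gap without the first. It is
still realizable, since the second gain is at most the first. -/
theorem exists_gain (hv : SortedBelow v n) (s : Finset Bool) : ∃ Q : Finset ℝ, Q.card ≤ s.card ∧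
    ∃ W ⊆ Finset.range n, ∑ b ∈ s, gain v n p p' b ≤ W.card ∧ ∀ a ∈ W, p < v a ∧ v a < p' ∧
      ∃ q ∈ Q, |v a - q| < v a - p ∧ |v a - q| < p' - v a := by
  have h12 := gainOne_le_gainTwo (v := v) (n := n) (p := p) (p' := p')
  have h21 := gainTwo_le_two_mul (p := p) (p' := p') hv
  by_cases h0 : s = ∅
  · subst h0
    exact ⟨∅, by simp, ∅, by simp, by simp, by simp⟩
  by_cases h2 : s = Finset.univ
  · subst h2
    obtain ⟨Q, hQ, W, hW, hWc, h⟩ := exists_gainTwo (p := p) (p' := p') hv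
    refine ⟨Q, by simpa using hQ, W, hW, ?_, h⟩
    simp only [Fintype.univ_bool, Finset.mem_singleton, Bool.true_eq_false, not_false_eq_true,
      Finset.sum_insert, gain, Finset.sum_singleton]
    omega
  · obtain ⟨q, W, hW, hWc, h⟩ := exists_gainOne (p := p) (p' := p') hv
    refine ⟨{q}, ?_, W, hW, ?_, fun a ha => ⟨(h a ha).1, (h a ha).2.1, q, by simp, (h a ha).2.2⟩⟩
    · rw [Finset.card_singleton]
      exact Finset.card_pos.2 (Finset.nonempty_iff_ne_empty.2 h0)
    · have : ∀ s : Finset Bool, s ≠ ∅ → s ≠ Finset.univ → s = {false} ∨ s = {true} := by decide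
      rcases this s h0 h2 with rfl | rfl <;> simp only [Finset.sum_singleton, gain] <;> omega

end Gap

/-- Apply `exists_threshold` to the 2(k + 1) marginal gains of all gaps; the budget of a gap is the
total excess of its two gains over `t`. -/
theorem exists_step_le_card_lost {v : ℕ → ℝ} {n k l : ℕ} {p : ℕ → ℝ} (hv : SortedBelow v n)
    (hk : 1 ≤ k) (hp : ∀ i ≤ k, p i ≤ p (i + 1)) :
    ∃ t ≤ n, ∃ d : ℕ → ℕ, (∀ i ≤ k, Step v n t (d i) (p i) (p (i + 1))) ∧
      ∃ Q : Finset ℝ, Q.card = l ∧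
        l * t + ∑ i ∈ Finset.range (k + 1), d i ≤ (lost v n (chainSet p k) Q).card := by
  classical
  have mono : ∀ i j, i ≤ j → j ≤ k + 1 → p i ≤ p j := by
    intro i j hij
    induction j, hij using Nat.le_induction with
    | base => exact fun _ => le_rfl
    | succ j _ ih => exact fun h => (ih (by omega)).trans (hp j (by omega))
  set G : ℕ × Bool → ℕ := fun x => gain v n (p x.1) (p (x.1 + 1)) x.2
  obtain ⟨t, htn, S, hSA, hSl, hS⟩ := exists_threshold
    (Finset.range (k + 1) ×ˢ (Finset.univ : Finset Bool)) G n l (by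
      rintro ⟨i, b⟩ -
      have := gainTwo_le (v := v) (n := n) (p := p i) (p' := p (i + 1))
      have := gainOne_le_gainTwo (v := v) (n := n) (p := p i) (p' := p (i + 1))
      cases b <;> simp only [G, gain] <;> omega)
  refine ⟨t, htn, fun i => gain v n (p i) (p (i + 1)) false - t +
    (gain v n (p i) (p (i + 1)) true - t), fun i _ => step_of_gain hv t, ?_⟩
  set s : ℕ → Finset Bool := fun i => Finset.univ.filter fun b => (i, b) ∈ S
  choose Q hQ W hW hWc hWs using fun i => exists_gain (p := p i) (p' := p (i + 1)) hv (s i)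
  have sumS : ∀ f : ℕ × Bool → ℕ,
      ∑ x ∈ S, f x = ∑ i ∈ Finset.range (k + 1), ∑ b ∈ s i, f (i, b) := by
    intro f
    rw [← Finset.inter_eq_right.2 hSA, ← Finset.filter_mem_eq_inter, Finset.sum_filter,
      Finset.sum_product]
    simp only [s, Finset.sum_filter]
  have hQc : ((Finset.range (k + 1)).biUnion Q).card ≤ l := by
    refine (Finset.card_biUnion_le.trans (Finset.sum_le_sum fun i _ => hQ i)).trans ?_
    refine le_trans (le_of_eq ?_) hSl
    simpa using (sumS fun _ => 1).symm
  -- Spare points are placed arbitrarily: a larger `Q` loses none of the voters it has won.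
  obtain ⟨Q', hsub, hQ'⟩ := Infinite.exists_superset_card_eq _ l hQc
  refine ⟨Q', hQ', ?_⟩
  have hdisj : (Finset.range (k + 1) : Set ℕ).PairwiseDisjoint W := by
    have : ∀ i j, j ≤ k → i < j → Disjoint (W i) (W j) := by
      intro i j hj hij
      rw [Finset.disjoint_left]
      intro a h1 h2
      linarith [(hWs i a h1).2.1, (hWs j a h2).1, mono (i + 1) j hij (by omega)]
    intro i hi j hj hij
    simp only [Finset.coe_range, Set.mem_Iio] at hi hj
    rcases lt_or_gt_of_ne hij with h | h
    · exact this i j (by omega) h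
    · exact (this j i (by omega) h).symm
  have hWl : (Finset.range (k + 1)).biUnion W ⊆ lost v n (chainSet p k) Q' := by
    intro a ha
    obtain ⟨i, hi, ha⟩ := Finset.mem_biUnion.1 ha
    rw [Finset.mem_range] at hi
    obtain ⟨h1, h2, q, hq, h3, h4⟩ := hWs i a ha
    have hqQ : q ∈ Q' := hsub (Finset.mem_biUnion.2 ⟨i, Finset.mem_range.2 hi, hq⟩)
    refine (mem_lost ⟨_, mem_chainSet le_rfl hk⟩ ⟨q, hqQ⟩).2
      ⟨Finset.mem_range.1 (hW i ha), q, hqQ, fun x hx => ?_⟩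
    obtain ⟨j, hj, rfl⟩ := Finset.mem_image.1 hx
    rw [Finset.mem_Icc] at hj
    rcases Nat.lt_or_ge i j with hij | hij
    · have := mono (i + 1) j hij (by omega)
      rw [abs_of_nonpos (a := v a - p j) (by linarith)]
      linarith
    · have := mono j i hij (by omega)
      rw [abs_of_nonneg (a := v a - p j) (by linarith)]
      linarith
  refine le_trans ?_ (Finset.card_le_card hWl)
  rw [Finset.card_biUnion hdisj]
  refine le_trans ?_ (Finset.sum_le_sum fun i _ => hWc i)
  rw [← sumS G]
  refine le_trans (le_of_eq ?_) hS
  rw [Finset.sum_product]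
  congr 1
  refine Finset.sum_congr rfl fun i _ => ?_
  simp [G, add_comm]

end VoronoiGame

namespace VoronoiGame

/-! ### The dynamic program -/

/-- The part of `nextPoint` that takes the first `b` voters into account. -/
noncomputable def nextAux (v : ℕ → ℝ) (n m m' : ℕ) (p : ℝ) : ℕ → ℝ
  | 0 => max (rightEnd v n) (p + 1)
  | a + 1 =>
    if p < v a then
      min (min (nextAux v n m m' p a)
        (if a + m < n then max (v (a + m)) (p + (v (a + m) - v a + (v (a + m) - v a)))
          else nextAux v n m m' p a))
        (if a + m' < n then v (a + m') else nextAux v n m m' p a)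
    else nextAux v n m m' p a

/-- The rightmost point that can follow `p` at cost `d`. -/
noncomputable def nextPoint (v : ℕ → ℝ) (n t d : ℕ) (p : ℝ) : ℝ :=
  nextAux v n (t + d) (t + d + t) p n

section

variable {v : ℕ → ℝ} {n m m' t d : ℕ} {p p' x : ℝ}

theorem le_nextAux_iff {b : ℕ} : x ≤ nextAux v n m m' p b ↔ x ≤ max (rightEnd v n) (p + 1) ∧
    ∀ a < b, p < v a →
      (a + m < n → x ≤ max (v (a + m)) (p + (v (a + m) - v a + (v (a + m) - v a)))) ∧
      (a + m' < n → x ≤ v (a + m')) := by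
  induction b with
  | zero => simp [nextAux]
  | succ b ih =>
    simp only [Nat.lt_succ_iff_lt_or_eq, or_imp, forall_and, forall_eq]
    simp only [forall_and] at ih
    rw [nextAux]
    split_ifs <;> simp only [le_min_iff, *] <;> tauto

/-- All conditions in `Step` are upper bounds on the next point, so the admissible points form a
down-set, and `nextPoint` is its maximum after capping. -/
theorem le_nextPoint_iff : x ≤ nextPoint v n t d p ↔
    x ≤ max (rightEnd v n) (p + 1) ∧ Step v n t d p x := by
  rw [nextPoint, le_nextAux_iff]
  refine and_congr_right fun _ => ⟨fun h => ⟨fun a ha han => ?_, fun a ha han => ?_⟩,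
    fun h a _ ha => ⟨h.1 a ha, h.2 a ha⟩⟩
  · exact (h a (by omega) ha).1 han
  · exact (h a (by omega) ha).2 han

theorem step_nextPoint : Step v n t d p (nextPoint v n t d p) := (le_nextPoint_iff.1 le_rfl).2

/-- The cap is at least p + 1 so that chains increase strictly, even beyond the last voter; this
gives k distinct points in the end. -/
theorem lt_nextAux (hv : SortedBelow v n) (b : ℕ) : p < nextAux v n m m' p b := by
  induction b with
  | zero => exact lt_max_of_lt_right (lt_add_one p)
  | succ b ih =>
    rw [nextAux]
    split_ifs with h1 h2 h3 h3 <;> simp only [lt_min_iff, lt_max_iff, ih, true_and, and_true]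
    · exact ⟨Or.inl (h1.trans_le (hv b _ (by omega) h2)), h1.trans_le (hv b _ (by omega) h3)⟩
    · exact Or.inl (h1.trans_le (hv b _ (by omega) h2))
    · exact h1.trans_le (hv b _ (by omega) h3)

theorem lt_nextPoint (hv : SortedBelow v n) : p < nextPoint v n t d p := lt_nextAux hv n

theorem lt_rightEnd (hv : SortedBelow v n) {a : ℕ} (ha : a < n) : v a < rightEnd v n := by
  rw [rightEnd]
  linarith [hv 0 a (by omega) ha, hv a (n - 1) (by omega) (by omega)]

/-- Starting further right never hurts: fewer voters impose bounds, and the bounds grow with the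
starting point. Truncating at `rightEnd` allows for the cap; no voter is left once `x` has reached
it. -/
theorem min_le_nextPoint (hv : SortedBelow v n) (h : Step v n t d p p')
    (hx : min p (rightEnd v n) ≤ x) : min p' (rightEnd v n) ≤ nextPoint v n t d x := by
  have key : ∀ a < n, x < v a → p ≤ x := fun a han ha =>
    (min_le_iff.1 hx).resolve_right (by linarith [lt_rightEnd hv han])
  refine le_nextPoint_iff.2 ⟨(min_le_right _ _).trans (le_max_left _ _),
    fun a ha han => (min_le_left _ _).trans ?_, fun a ha han => (min_le_left _ _).trans ?_⟩
  · have hp := key a (by omega) ha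
    exact (h.1 a (hp.trans_lt ha) han).trans (max_le_max le_rfl (by linarith))
  · exact h.2 a ((key a (by omega) ha).trans_lt ha) han

/-- `x` is the best entry for budget `c` that extends the row of the table `X` starting at index
`b`, and `i` is the index of the entry that it extends. -/
def IsEntry (v : ℕ → ℝ) (n t : ℕ) (X : ℕ → ℝ) (b c : ℕ) (x : ℝ) (i : ℕ) : Prop :=
  (∃ c' ≤ c, i = b + c' ∧ x = nextPoint v n t (c - c') (X (b + c'))) ∧
    ∀ c' ≤ c, nextPoint v n t (c - c') (X (b + c')) ≤ x

/-- Rows `0` to `J` of `X` hold the rightmost points that can be reached, indexed by the cost, and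
`B` holds the predecessors. -/
def IsTable (v : ℕ → ℝ) (n t J : ℕ) (X : ℕ → ℝ) (B : ℕ → ℕ) : Prop :=
  (∀ c ≤ n, X c = leftEnd v n) ∧ ∀ j < J, ∀ c ≤ n, IsEntry v n t X (j * (n + 1)) c
    (X ((j + 1) * (n + 1) + c)) (B ((j + 1) * (n + 1) + c))

variable {J : ℕ} {X : ℕ → ℝ} {B : ℕ → ℕ}

/-- Soundness of the table: following the predecessors back from an entry yields an increasing chain
of steps whose total cost fits the entry's budget. -/
theorem IsTable.chain (hv : SortedBelow v n) (h : IsTable v n t J X B) :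
    ∀ j ≤ J, ∀ c ≤ n, X (B^[j] (j * (n + 1) + c)) = leftEnd v n ∧
      ∃ d : ℕ → ℕ, ∑ i ∈ Finset.range j, d i ≤ c ∧ ∀ i < j,
        Step v n t (d i) (X (B^[j - i] (j * (n + 1) + c)))
          (X (B^[j - (i + 1)] (j * (n + 1) + c))) ∧
        X (B^[j - i] (j * (n + 1) + c)) < X (B^[j - (i + 1)] (j * (n + 1) + c)) := by
  intro j
  induction j with
  | zero => intro _ c hc; exact ⟨by simpa using h.1 c hc, 0, by simp, by simp⟩
  | succ j ih =>
    intro hj c hc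
    obtain ⟨⟨c', hc', hB, hX⟩, -⟩ := h.2 j (by omega) c hc
    obtain ⟨h0, d, hd, hs⟩ := ih (by omega) c' (by omega)
    refine ⟨by rw [Function.iterate_succ_apply, hB]; exact h0, Function.update d j (c - c'), ?_,
      fun i hi => ?_⟩
    · rw [Finset.sum_range_succ, Function.update_self,
        Finset.sum_congr rfl fun i hi => Function.update_of_ne (Finset.mem_range.1 hi).ne _ _]
      omega
    · rcases Nat.lt_succ_iff_lt_or_eq.1 hi with hi | rfl
      · rw [Function.update_of_ne hi.ne, show j + 1 - i = (j - i) + 1 by omega,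
          show j + 1 - (i + 1) = (j - (i + 1)) + 1 by omega, Function.iterate_succ_apply,
          Function.iterate_succ_apply, hB]
        exact hs i hi
      · rw [Function.update_self, Nat.sub_self, show i + 1 - i = 1 by omega, Function.iterate_one,
          Function.iterate_zero_apply, hB, hX]
        exact ⟨step_nextPoint, lt_nextPoint hv⟩

/-- Completeness of the table: by induction, using the entry for the cost spent so far as
predecessor, any chain is matched, up to truncation, by the entry of the same total cost. -/
theorem IsTable.min_le (hv : SortedBelow v n) (h : IsTable v n t J X B) {q : ℕ → ℝ} {d : ℕ → ℕ}
    (hq0 : q 0 ≤ leftEnd v n) (hq : ∀ i < J, Step v n t (d i) (q i) (q (i + 1))) :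
    ∀ j ≤ J, ∑ i ∈ Finset.range j, d i ≤ n →
      min (q j) (rightEnd v n) ≤ X (j * (n + 1) + ∑ i ∈ Finset.range j, d i) := by
  intro j
  induction j with
  | zero => intro _ _; simpa [h.1 0 (by omega)] using Or.inl hq0
  | succ j ih =>
    intro hj hd
    have hle : ∑ i ∈ Finset.range j, d i ≤ ∑ i ∈ Finset.range (j + 1), d i := by
      rw [Finset.sum_range_succ]; omega
    refine le_trans ?_ ((h.2 j (by omega) _ hd).2 _ hle)
    rw [show ∑ i ∈ Finset.range (j + 1), d i - ∑ i ∈ Finset.range j, d i = d j by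
      rw [Finset.sum_range_succ]; omega]
    exact min_le_nextPoint hv (hq j (by omega)) (ih (by omega) (hle.trans hd))

end

/-! ### From table entries to optimal strategies. -/

section

variable {v : ℕ → ℝ} {n k l : ℕ}

/-- The points recorded along the predecessors of index `e`. -/
noncomputable def tracedSet (X : ℕ → ℝ) (B : ℕ → ℕ) (k e : ℕ) : Finset ℝ :=
  (Finset.range k).image fun i => X (B^[i + 1] e)

/-- The traceback, read in reverse, is a chain to which `card_lost_le` applies. The iterates 1, ...,
k omit the artificial end points in rows k + 1 and 0. -/
theorem IsTable.tracedSet_spec {t c : ℕ} {X : ℕ → ℝ} {B : ℕ → ℕ} (hv : SortedBelow v n)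
    (hk : 1 ≤ k) (h : IsTable v n t (k + 1) X B) (hc : c ≤ n)
    (hX : rightEnd v n ≤ X ((k + 1) * (n + 1) + c)) :
    (tracedSet X B k ((k + 1) * (n + 1) + c)).card = k ∧ ∀ Q : Finset ℝ, Q.card = l → 1 ≤ l →
      (lost v n (tracedSet X B k ((k + 1) * (n + 1) + c)) Q).card ≤ l * t + c := by
  set e := (k + 1) * (n + 1) + c
  obtain ⟨h0, d, hd, hs⟩ := h.chain hv (k + 1) le_rfl c hc
  set p : ℕ → ℝ := fun i => X (B^[k + 1 - i] e) with hp
  have hset : tracedSet X B k e = chainSet p k := by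
    ext x
    simp only [tracedSet, chainSet, Finset.mem_image, Finset.mem_range, Finset.mem_Icc]
    constructor
    · rintro ⟨i, hi, rfl⟩
      exact ⟨k - i, by omega, by simp only [hp]; congr 2; omega⟩
    · rintro ⟨i, hi, rfl⟩
      exact ⟨k - i, by omega, by simp only [hp]; congr 2; omega⟩
  have hmono : ∀ i j, i < j → j ≤ k + 1 → p i < p j := by
    intro i j hij
    induction j, hij using Nat.le_induction with
    | base => exact fun hj => (hs i (by omega)).2
    | succ j hij ih => exact fun hj => (ih (by omega)).trans (hs j (by omega)).2
  rw [hset]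
  constructor
  · rw [chainSet, Finset.card_image_of_injOn, Nat.card_Icc, Nat.add_sub_cancel]
    intro i hi j hj hij
    simp only [Finset.coe_Icc, Set.mem_Icc] at hi hj
    rcases lt_trichotomy i j with h | h | h
    · exact absurd hij (hmono i j h (by omega)).ne
    · exact h
    · exact absurd hij (hmono j i h (by omega)).ne'
  · intro Q hQ hl
    refine (card_lost_le (d := d) hv hk h0 ?_ (fun i hi => (hs i (by omega)).1)
      (Finset.card_pos.1 (by omega))).trans (by rw [hQ]; omega)
    simpa [hp] using hX

/-- The sorted points of `P` are framed by artificial ends that also lie beyond `P` itself, since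
`P` may have points far outside the voters. -/
theorem exists_chain {P : Finset ℝ} (hP : P.card = k) (hk : 1 ≤ k) (x y : ℝ) :
    ∃ p : ℕ → ℝ, p 0 ≤ x ∧ y ≤ p (k + 1) ∧ (∀ i ≤ k, p i ≤ p (i + 1)) ∧ chainSet p k = P := by
  have hne : P.Nonempty := Finset.card_pos.1 (by omega)
  set p : ℕ → ℝ := fun j => if j = 0 then min x (P.min' hne) else
    if h : j - 1 < k then P.orderEmbOfFin hP ⟨j - 1, h⟩ else max y (P.max' hne) with hp
  have hmid : ∀ j, 1 ≤ j → (hj : j - 1 < k) → p j = P.orderEmbOfFin hP ⟨j - 1, hj⟩ := by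
    intro j h1 h2
    simp only [hp]
    rw [if_neg (by omega), dif_pos h2]
  have h0 : p 0 = min x (P.min' hne) := by simp [hp]
  have h1 : p (k + 1) = max y (P.max' hne) := by simp [hp]
  refine ⟨p, h0 ▸ min_le_left _ _, h1 ▸ le_max_left _ _, fun i hi => ?_, ?_⟩
  · rcases Nat.eq_zero_or_pos i with rfl | hi0
    · rw [h0, hmid 1 le_rfl hk]
      exact (min_le_right _ _).trans (P.min'_le _ (P.orderEmbOfFin_mem hP _))
    rcases hi.lt_or_eq with hlt | rfl
    · rw [hmid i hi0 (by omega), hmid (i + 1) (by omega) (by omega)]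
      exact (P.orderEmbOfFin hP).monotone (Fin.mk_le_mk.2 (by omega))
    · rw [h1, hmid i hi0 (by omega)]
      exact (P.le_max' _ (P.orderEmbOfFin_mem hP _)).trans (le_max_right _ _)
  · refine Finset.eq_of_subset_of_card_le (fun z hz => ?_) ?_
    · obtain ⟨i, hi, rfl⟩ := Finset.mem_image.1 hz
      rw [Finset.mem_Icc] at hi
      rw [hmid i hi.1 (by omega)]
      exact P.orderEmbOfFin_mem hP _
    · rw [chainSet, Finset.card_image_of_injOn, Nat.card_Icc]
      · omega
      intro i hi j hj hij
      simp only [Finset.coe_Icc, Set.mem_Icc] at hi hj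
      rw [hmid i hi.1 (by omega), hmid j hj.1 (by omega)] at hij
      have := congrArg Fin.val ((P.orderEmbOfFin hP).injective hij)
      simp only at this
      omega

/-- The pair comes from the best reply to `P`. Its budget is at most n because no reply wins more
than n voters, and the table dominates the chain of `P`. -/
theorem exists_budget (hv : SortedBelow v n) (hk : 1 ≤ k) {P : Finset ℝ} (hP : P.card = k) :
    ∃ t ≤ n, ∃ c ≤ n, (∃ Q : Finset ℝ, Q.card = l ∧ l * t + c ≤ (lost v n P Q).card) ∧
      ∀ X B, IsTable v n t (k + 1) X B → rightEnd v n ≤ X ((k + 1) * (n + 1) + c) := by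
  obtain ⟨p, h0, h1, hp, rfl⟩ := exists_chain hP hk (leftEnd v n) (rightEnd v n)
  obtain ⟨t, ht, d, hd, Q, hQ, hle⟩ := exists_step_le_card_lost (l := l) hv hk hp
  have hn : (lost v n (chainSet p k) Q).card ≤ n := by
    have := card_won_add_card_lost v n (chainSet p k) Q
    omega
  refine ⟨t, ht, ∑ i ∈ Finset.range (k + 1), d i, by omega, ⟨Q, hQ, hle⟩, fun X B hX => ?_⟩
  have := hX.min_le hv h0 (fun i hi => hd i (by omega)) (k + 1) le_rfl (by omega)
  rwa [min_eq_right h1] at this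

/-- `P` loses at most `b` voters, and every strategy can be made to lose `b` voters. -/
def IsOptimal (v : ℕ → ℝ) (n k l b : ℕ) (P : Finset ℝ) : Prop :=
  P.card = k ∧ (∀ Q : Finset ℝ, Q.card = l → (lost v n P Q).card ≤ b) ∧
    ∀ P' : Finset ℝ, P'.card = k → ∃ Q : Finset ℝ, Q.card = l ∧ b ≤ (lost v n P' Q).card

theorem IsOptimal.realizes {b : ℕ} {P : Finset ℝ} (h : IsOptimal v n k l b P) :
    Realizes ((Multiset.range n).map v) l P (n - b) := by
  intro Q hQ
  have := card_won_add_card_lost v n P Q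
  have := h.2.1 Q hQ
  omega

theorem IsOptimal.gam_eq {b : ℕ} {P : Finset ℝ} (h : IsOptimal v n k l b P) :
    Gam k l ((Multiset.range n).map v) = n - b := by
  have hle : ∀ P' : {P : Finset ℝ // P.card = k}, (⨅ Q : {Q : Finset ℝ // Q.card = l},
      (won ((Multiset.range n).map v) P'.1 Q.1).card) ≤ n - b := by
    intro P'
    obtain ⟨Q, hQ, hb⟩ := h.2.2 P'.1 P'.2
    refine (ciInf_le (OrderBot.bddBelow _) ⟨Q, hQ⟩).trans ?_
    have := card_won_add_card_lost v n P'.1 Q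
    simp only
    omega
  have : Nonempty {P : Finset ℝ // P.card = k} := ⟨⟨P, h.1⟩⟩
  have : Nonempty {Q : Finset ℝ // Q.card = l} := by
    obtain ⟨Q, hQ, -⟩ := h.2.2 P h.1
    exact ⟨⟨Q, hQ⟩⟩
  refine le_antisymm (ciSup_le hle) ?_
  exact le_ciSup_of_le ⟨n - b, by rintro _ ⟨P', rfl⟩; exact hle P'⟩ ⟨P, h.1⟩
    (le_ciInf fun Q => h.realizes Q.1 Q.2)

theorem IsOptimal.hasWinningStrategy_iff {b : ℕ} {P : Finset ℝ} (h : IsOptimal v n k l b P) :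
    HasWinningStrategy ((Multiset.range n).map v) k l ↔ n ≤ (n - b) + (n - b) := by
  simp only [HasWinningStrategy, Multiset.card_map, Multiset.card_range]
  constructor
  · rintro ⟨P', hP', hw⟩
    obtain ⟨Q, hQ, hb⟩ := h.2.2 P' hP'
    have h1 := hw Q hQ
    have h2 := card_won_add_card_lost v n P' Q
    have h3 : (n : ℝ) ≤ ((won ((Multiset.range n).map v) P' Q).card +
        (won ((Multiset.range n).map v) P' Q).card : ℕ) := by
      push_cast
      linarith
    have := Nat.cast_le.1 h3
    omega
  · intro hn
    refine ⟨P, h.1, fun Q hQ => ?_⟩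
    have h1 : n ≤ (won ((Multiset.range n).map v) P Q).card +
        (won ((Multiset.range n).map v) P Q).card := by
      have := h.realizes Q hQ
      omega
    have h2 : (n : ℝ) ≤ (won ((Multiset.range n).map v) P Q).card +
        (won ((Multiset.range n).map v) P Q).card := by exact_mod_cast h1
    linarith

end

end VoronoiGame

/-! ### The program for one greedy step. -/

namespace VoronoiGame

open RealRAM

/-- Computes `nextPoint` of register `2` into register `3`. -/
def nextProgram : Program :=
  .seq (ops [.realConst 3 1, .realAdd 3 2 3]) <| .seq (maxInto 3 1) <| forLoop 3 20 0 <|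
    .seq (ops [.realLoad 4 0 20]) <| .branch (.realLt 2 4)
      (.seq
        (.seq (ops [.natAdd 21 20 18]) <| .branch (.natLt 21 0)
          (.seq (ops [.realLoad 5 0 21, .realSub 6 5 4, .realAdd 6 6 6, .realAdd 6 2 6]) <|
            .seq (maxInto 6 5) (minInto 3 6))
          .skip) <|
        .seq (ops [.natAdd 21 20 19]) <| .branch (.natLt 21 0)
          (.seq (ops [.realLoad 5 0 21]) (minInto 3 5)) .skip)
      .skip

theorem nextProgram_spec {s : Store} {v : ℕ → ℝ} {n t d : ℕ}
    (h0 : s.nat 0 = n) (h3 : s.nat 3 = 1)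
    (h18 : s.nat 18 = t + d) (h19 : s.nat 19 = t + d + t) (hm : s.realMem 0 = v)
    (h1 : s.real 1 = rightEnd v n) :
    Ends nextProgram (n * 60 + 60) (fun s' => s'.real 3 = nextPoint v n t d (s.real 2)) s := by
  apply Ends.le
  · apply Ends.ops_seq
    apply Ends.seq
    apply Ends.of_maxInto
    refine (Ends.forLoop (N := n) (T := 50)
      (fun a s' => s'.real 3 = nextAux v n (t + d) (t + d + t) (s.real 2) a)
      (by decide) (by decide) (by rfl) (by rfl) (by rfl) ?_ ?_ ?_ ?_).mono le_rfl
      (fun s' _ h => h.2)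
    · simpa [execs, Op.exec] using h0
    · simpa [execs, Op.exec] using h3
    · simp [execs, Op.exec, Store.setNat, nextAux, h1, max_comm]
    · intro a s₁ ha hf hx hI
      have g2 := hf.real 2 (by rfl)
      have g0 := hf.nat 0 (by rfl)
      have g18 := hf.nat 18 (by rfl)
      have g19 := hf.nat 19 (by rfl)
      have gm := hf.realMem 0 (by rfl)
      simp [execs, Op.exec, h0, h18, h19, hm] at g2 g0 g18 g19 gm
      apply Ends.le
      · apply Ends.ops_seq
        simp only [execs, Op.exec]
        apply Ends.branch
        · intro hb
          simp [Test.holds, hx, gm, g2] at hb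
          apply Ends.seq
          apply Ends.ops_seq
          simp only [execs, Op.exec]
          -- The second half of the loop body, stated once for both outcomes of the first test.
          have key : ∀ s₂ : Store, s₂.nat 20 = a → s₂.nat 19 = t + d + t → s₂.nat 0 = n →
              s₂.realMem 0 = v → s₂.real 3 = min (nextAux v n (t + d) (t + d + t) (s.real 2) a)
                (if a + (t + d) < n then max (v (a + (t + d))) (s.real 2 +
                  (v (a + (t + d)) - v a + (v (a + (t + d)) - v a)))
                else nextAux v n (t + d) (t + d + t) (s.real 2) a) →
              Ends (.seq (ops [.natAdd 21 20 19]) <| .branch (.natLt 21 0)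
                (.seq (ops [.realLoad 5 0 21]) (minInto 3 5)) .skip) 20
                (fun s' => (s'.setNat 20 (a + 1)).real 3 =
                  nextAux v n (t + d) (t + d + t) (s.real 2) (a + 1)) s₂ := by
            intro s₂ k20 k19 k0 km k3
            apply Ends.le
            · apply Ends.ops_seq
              simp only [execs, Op.exec]
              apply Ends.branch
              · intro hc
                simp [Test.holds, k20, k19, k0] at hc
                apply Ends.ops_seq
                apply Ends.of_minInto
                simp [execs, Op.exec, Store.setNat, nextAux, hb, hc, k20, k19, km, k3]
              · intro hc
                simp [Test.holds, k20, k19, k0] at hc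
                apply Ends.of_skip
                simp [Store.setNat, nextAux, hb, not_lt.2 hc, k3]
            · simp
          apply Ends.branch
          · intro hc
            simp [Test.holds, hx, g18, g0] at hc
            apply Ends.ops_seq
            apply Ends.seq
            apply Ends.of_maxInto
            apply Ends.of_minInto
            apply key <;> simp [execs, Op.exec, hx, g0, g18, g19, gm, g2, hI, hc, max_comm]
          · intro hc
            simp [Test.holds, hx, g18, g0] at hc
            apply Ends.of_skip
            apply key <;> simp [hx, g0, g19, gm, hI, not_lt.2 hc]
        · intro hb
          simp [Test.holds, hx, gm, g2] at hb
          apply Ends.of_skip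
          simp [Store.setNat, nextAux, hb, hI]
      · simp
  · simp; omega

end VoronoiGame

/-! ### The program for one table entry. -/

namespace VoronoiGame

open RealRAM

theorem frame_ops (l : List Op) (s : Store) : Frame (ops l) s (execs l s) := by
  obtain ⟨_, _, hr, -, rfl⟩ := Ends.of_ops (l := l) (Q := (· = execs l s)) rfl
  exact hr.frame

/-- The registers that hold the parameters of the game, the sorted voters, and the threshold. -/
structure Context (v : ℕ → ℝ) (n k l t : ℕ) (s : Store) : Prop where
  nat0 : s.nat 0 = n
  nat1 : s.nat 1 = k
  nat2 : s.nat 2 = l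
  nat3 : s.nat 3 = 1
  nat4 : s.nat 4 = n + 1
  nat5 : s.nat 5 = k + 1
  nat8 : s.nat 8 = t
  real0 : s.real 0 = leftEnd v n
  real1 : s.real 1 = rightEnd v n
  mem0 : s.realMem 0 = v

/-- Whether a program does not write the locations that `Context` refers to. -/
def keepsContext (p : Program) : Bool :=
  !(p.anyOp fun o => o.writesNat 0 || o.writesNat 1 || o.writesNat 2 || o.writesNat 3 ||
    o.writesNat 4 || o.writesNat 5 || o.writesNat 8 || o.writesReal 0 || o.writesReal 1 ||
    o.writesRealMem 0)

theorem anyOp_or (f g : Op → Bool) (p : Program) :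
    p.anyOp (fun o => f o || g o) = (p.anyOp f || p.anyOp g) := by
  induction p with
  | skip => rfl
  | op o => rfl
  | seq p q hp hq => simp only [Program.anyOp, hp, hq]; ac_rfl
  | branch _ p q hp hq => simp only [Program.anyOp, hp, hq]; ac_rfl
  | loop _ p hp => simp only [Program.anyOp, hp]

theorem Context.frame {v : ℕ → ℝ} {n k l t : ℕ} {s s' : Store} {p : Program}
    (h : Context v n k l t s) (hf : Frame p s s') (hp : keepsContext p = true) :
    Context v n k l t s' := by
  simp only [keepsContext, anyOp_or, Bool.not_eq_true', Bool.or_eq_false_iff] at hp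
  obtain ⟨⟨⟨⟨⟨⟨⟨⟨⟨h0, h1⟩, h2⟩, h3⟩, h4⟩, h5⟩, h8⟩, r0⟩, r1⟩, m0⟩ := hp
  exact ⟨(hf.nat 0 h0).trans h.nat0, (hf.nat 1 h1).trans h.nat1, (hf.nat 2 h2).trans h.nat2,
    (hf.nat 3 h3).trans h.nat3, (hf.nat 4 h4).trans h.nat4, (hf.nat 5 h5).trans h.nat5,
    (hf.nat 8 h8).trans h.nat8, (hf.real 0 r0).trans h.real0, (hf.real 1 r1).trans h.real1,
    (hf.realMem 0 m0).trans h.mem0⟩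

/-- Computes the table entry for budget `c` (register `12`) in the row that starts at the index in
register `10`, from the row that starts at the index in register `9`. -/
def entryProgram : Program :=
  .seq (ops [.natAdd 13 10 12, .natAdd 14 12 3, .realCopy 7 0]) <|
  .seq (forLoop 3 15 14 <|
    .seq (ops [.natAdd 16 9 15, .realLoad 2 2 16, .natSub 17 12 15, .natAdd 18 8 17,
      .natAdd 19 18 8]) <|
    .seq nextProgram <|
    .branch (.realLt 7 3) (ops [.realCopy 7 3, .natCopy 22 16]) .skip) <|
  ops [.realStore 2 13 7, .natStore 0 13 22]

theorem entryProgram_spec {s : Store} {v : ℕ → ℝ} {n k l t b b' c : ℕ} (hv : SortedBelow v n)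
    (h : Context v n k l t s) (h9 : s.nat 9 = b) (h10 : s.nat 10 = b') (h12 : s.nat 12 = c)
    (hc : c ≤ n) (hX : ∀ c' ≤ c, leftEnd v n ≤ s.realMem 2 (b + c')) :
    Ends entryProgram ((n + 1) * (n * 60 + 100) + 20) (fun s' => ∃ x i,
      IsEntry v n t (s.realMem 2) b c x i ∧
      s'.realMem 2 = Function.update (s.realMem 2) (b' + c) x ∧
      s'.natMem 0 = Function.update (s.natMem 0) (b' + c) i) s := by
  set X := s.realMem 2
  apply Ends.le
  · apply Ends.ops_seq
    refine Ends.seq_of (T₂ := 3) (Ends.forLoop (N := c + 1) (T := n * 60 + 90)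
      (fun i s' => (i = 0 ∧ s'.real 7 = leftEnd v n ∨
          ∃ c' < i, s'.nat 22 = b + c' ∧ s'.real 7 = nextPoint v n t (c - c') (X (b + c'))) ∧
        ∀ c' < i, nextPoint v n t (c - c') (X (b + c')) ≤ s'.real 7)
      (by decide) (by decide) (by rfl) (by rfl) (by rfl) ?_ ?_ ?_ ?_) ?_
    · simp [execs, Op.exec, h12, h.nat3]
    · simp [execs, Op.exec, h.nat3]
    · simp [execs, Op.exec, Store.setNat, h.real0]
    · intro i s₁ hi hf hx hI
      have hC : Context v n k l t s₁ := (h.frame (frame_ops _ _) (by rfl)).frame hf (by rfl)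
      have g9 := hf.nat 9 (by rfl)
      have g12 := hf.nat 12 (by rfl)
      have gm := hf.realMem 2 (by rfl)
      simp [execs, Op.exec, h9, h12] at g9 g12 gm
      apply Ends.le
      · apply Ends.ops_seq
        have hC' : Context v n k l t _ := hC.frame (frame_ops [.natAdd 16 9 15, .realLoad 2 2 16,
          .natSub 17 12 15, .natAdd 18 8 17, .natAdd 19 18 8] _) (by rfl)
        refine Ends.seq_of (T₂ := 5) (nextProgram_spec (t := t) (d := c - i) hC'.nat0 hC'.nat3 ?_ ?_
          hC'.mem0 hC'.real1) ?_
        · simp [execs, Op.exec, hC.nat8, g12, hx]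
        · simp [execs, Op.exec, hC.nat8, g12, hx]
        · intro s₂ hf₂ h₂
          have f7 := hf₂.real 7 (by rfl)
          have f16 := hf₂.nat 16 (by rfl)
          have f22 := hf₂.nat 22 (by rfl)
          simp [execs, Op.exec, g9, hx, gm] at f7 f16 f22 h₂
          -- The running maximum starts at `leftEnd`, which every candidate strictly exceeds; so the
          -- first candidate always replaces it and register 22 gets a genuine predecessor.
          have hpos := hX i (by omega)
          have hlt : X (b + i) < nextPoint v n t (c - i) (X (b + i)) := lt_nextPoint hv
          obtain ⟨hI₁, hI₂⟩ := hI
          apply Ends.branch (T₁ := 3) (T₂ := 1)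
          · intro hb
            simp [Test.holds, f7, h₂] at hb
            apply Ends.of_ops
            simp only [execs, Op.exec, Store.setNat]
            refine ⟨Or.inr ⟨i, by omega, by simp [f16], by simp [h₂, X]⟩, fun c' hc' => ?_⟩
            simp only [Function.update_self, h₂]
            rcases Nat.lt_succ_iff_lt_or_eq.1 hc' with hc' | rfl
            · exact (hI₂ c' hc').trans hb.le
            · exact le_rfl
          · intro hb
            simp [Test.holds, f7, h₂] at hb
            apply Ends.of_skip
            simp [Store.setNat, f7, f22]
            refine ⟨?_, fun c' hc' => ?_⟩
            · rcases hI₁ with ⟨-, h7⟩ | ⟨c', h1, h2⟩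
              · rw [h7] at hb
                linarith
              · exact ⟨c', by omega, h2⟩
            · rcases hc'.lt_or_eq with hc' | rfl
              · exact hI₂ c' hc'
              · exact hb
      · simp; omega
    · rintro s₁ hf ⟨-, hI₁, hI₂⟩
      have g13 := hf.nat 13 (by rfl)
      have gm := hf.realMem 2 (by rfl)
      have gB := hf.natMem 0 (by rfl)
      simp [execs, Op.exec, h10, h12] at g13 gm gB
      apply Ends.of_ops
      refine ⟨s₁.real 7, s₁.nat 22, ⟨?_, fun c' hc' => hI₂ c' (by omega)⟩, ?_, ?_⟩
      · rcases hI₁ with ⟨h0, -⟩ | ⟨c', h1, h2⟩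
        · omega
        · exact ⟨c', by omega, h2⟩
      · simp [execs, Op.exec, g13, gm, X]
      · simp [execs, Op.exec, g13, gB]
  · have := Nat.mul_le_mul_right (n * 60 + 90 + 2) (by omega : c + 1 ≤ n + 1)
    have : (n + 1) * (n * 60 + 100) = (n + 1) * (n * 60 + 90 + 2) + (n + 1) * 8 := by ring
    simp
    omega

/-! ### Computing the whole table -/

/-- The table is complete up to row `J`, and in row `J + 1` for budgets below `i`. -/
def IsPartialTable (v : ℕ → ℝ) (n t J i : ℕ) (X : ℕ → ℝ) (B : ℕ → ℕ) : Prop :=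
  IsTable v n t J X B ∧ ∀ c < i, IsEntry v n t X (J * (n + 1)) c
    (X ((J + 1) * (n + 1) + c)) (B ((J + 1) * (n + 1) + c))

section

variable {v : ℕ → ℝ} {n t J i : ℕ} {X : ℕ → ℝ} {B : ℕ → ℕ}

theorem IsPartialTable.next (h : IsPartialTable v n t J (n + 1) X B) :
    IsPartialTable v n t (J + 1) 0 X B := by
  refine ⟨⟨h.1.1, fun j hj c hc => ?_⟩, by simp⟩
  rcases Nat.lt_succ_iff_lt_or_eq.1 hj with hj | rfl
  · exact h.1.2 j hj c hc
  · exact h.2 c (by omega)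

theorem IsEntry.congr {X' : ℕ → ℝ} {b c i : ℕ} {x : ℝ} (h : IsEntry v n t X b c x i)
    (hX : ∀ c' ≤ c, X' (b + c') = X (b + c')) : IsEntry v n t X' b c x i := by
  obtain ⟨⟨c', h1, h2, h3⟩, h4⟩ := h
  exact ⟨⟨c', h1, h2, by rw [hX c' h1, h3]⟩, fun c' hc' => by rw [hX c' hc']; exact h4 c' hc'⟩

/-- Filling a cell is harmless because the entries already established read only from rows up to
`J`, which lie strictly before it. -/
theorem IsPartialTable.update (h : IsPartialTable v n t J i X B) (hi : i ≤ n) {x : ℝ} {b : ℕ}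
    (he : IsEntry v n t X (J * (n + 1)) i x b) :
    IsPartialTable v n t J (i + 1) (Function.update X ((J + 1) * (n + 1) + i) x)
      (Function.update B ((J + 1) * (n + 1) + i) b) := by
  have row : ∀ j ≤ J, j * (n + 1) + (n + 1) ≤ (J + 1) * (n + 1) := fun j hj => by
    rw [← Nat.succ_mul]
    exact Nat.mul_le_mul_right _ (by omega)
  have hX : ∀ j ≤ J, ∀ c ≤ n, Function.update X ((J + 1) * (n + 1) + i) x (j * (n + 1) + c) =
      X (j * (n + 1) + c) := fun j hj c hc =>
    Function.update_of_ne (by have := row j hj; omega) _ _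
  refine ⟨⟨fun c hc => ?_, fun j hj c hc => ?_⟩, fun c hc => ?_⟩
  · simpa using (hX 0 (by omega) c hc).trans (by simpa using h.1.1 c hc)
  · rw [hX (j + 1) hj c hc, Function.update_of_ne (by have := row (j + 1) hj; omega)]
    exact (h.1.2 j hj c hc).congr fun c' hc' => hX j hj.le c' (by omega)
  · rcases Nat.lt_succ_iff_lt_or_eq.1 hc with hc | rfl
    · rw [Function.update_of_ne (by omega), Function.update_of_ne (by omega)]
      exact (h.2 c hc).congr fun c' hc' => hX J le_rfl c' (by omega)
    · rw [Function.update_self, Function.update_self]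
      exact he.congr fun c' hc' => hX J le_rfl c' (by omega)

theorem IsTable.leftEnd_le (hv : SortedBelow v n) (h : IsTable v n t J X B) :
    ∀ j ≤ J, ∀ c ≤ n, leftEnd v n ≤ X (j * (n + 1) + c) := by
  intro j
  induction j with
  | zero => intro _ c hc; simpa using (h.1 c hc).ge
  | succ j ih =>
    intro hj c hc
    obtain ⟨⟨c', hc', -, hX⟩, -⟩ := h.2 j (by omega) c hc
    rw [hX]
    exact (ih (by omega) c' (by omega)).trans (lt_nextPoint hv).le

end

/-- Computes the table for the threshold in register `8`. -/
def tableProgram : Program :=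
  .seq (forLoop 3 12 4 (ops [.realStore 2 12 0])) <|
  .seq (ops [.natConst 9 0]) <|
  forLoop 3 11 5 <|
    .seq (ops [.natAdd 10 9 4]) <|
    .seq (forLoop 3 12 4 entryProgram) <|
    ops [.natCopy 9 10]

theorem tableProgram_spec {s : Store} {v : ℕ → ℝ} {n k l t : ℕ} (hv : SortedBelow v n)
    (h : Context v n k l t s) :
    Ends tableProgram ((k + 1) * ((n + 1) * ((n + 1) * (n * 60 + 100) + 22) + 20) +
      (n + 1) * 10 + 20) (fun s' => IsTable v n t (k + 1) (s'.realMem 2) (s'.natMem 0) ∧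
        s'.nat 9 = (k + 1) * (n + 1)) s := by
  apply Ends.le
  · refine Ends.seq_of
      (T₂ := 2 + ((k + 1) * ((n + 1) * ((n + 1) * (n * 60 + 100) + 22) + 10 + 2) + 2))
      (Ends.forLoop (N := n + 1) (T := 2)
      (fun i s' => ∀ c < i, s'.realMem 2 c = leftEnd v n)
      (by decide) (by decide) (by rfl) (by rfl) (by rfl) h.nat4 h.nat3 (by simp) ?_) ?_
    · intro i s₁ hi hf hx hI
      have hC := h.frame hf (by rfl)
      apply Ends.of_ops
      intro c hc
      rcases Nat.lt_succ_iff_lt_or_eq.1 hc with hc | rfl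
      · simpa [execs, Op.exec, Store.setNat, hx, hc.ne] using hI c hc
      · simp [execs, Op.exec, Store.setNat, hx, hC.real0]
    · rintro s₁ hf ⟨-, hI⟩
      apply Ends.ops_seq
      have hC := (h.frame hf (by rfl)).frame (frame_ops [.natConst 9 0] s₁) (by rfl)
      refine (Ends.forLoop (N := k + 1) (T := (n + 1) * ((n + 1) * (n * 60 + 100) + 22) + 10)
        (fun j s' => IsPartialTable v n t j 0 (s'.realMem 2) (s'.natMem 0) ∧
          s'.nat 9 = j * (n + 1))
        (by decide) (by decide) (by rfl) (by rfl) (by rfl) hC.nat5 hC.nat3 ?_ ?_).mono le_rfl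
        (fun s' _ h => ⟨h.2.1.1, h.2.2⟩)
      · refine ⟨⟨⟨fun c hc => ?_, by simp⟩, by simp⟩, ?_⟩
        · simpa [execs, Op.exec, Store.setNat] using hI c (by omega)
        · simp [execs, Op.exec, Store.setNat]
      · rintro j s₂ hj hf₂ hx₂ ⟨hI₂, h9⟩
        have hC₂ := hC.frame hf₂ (by rfl)
        apply Ends.le
        · apply Ends.ops_seq
          have hC₃ := hC₂.frame (frame_ops [.natAdd 10 9 4] s₂) (by rfl)
          refine Ends.seq_of (T₂ := 2) (Ends.forLoop (N := n + 1) (T := (n + 1) * (n * 60 + 100) + 20)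
            (fun i s' => IsPartialTable v n t j i (s'.realMem 2) (s'.natMem 0))
            (by decide) (by decide) (by rfl) (by rfl) (by rfl) hC₃.nat4 hC₃.nat3 ?_ ?_) ?_
          · simpa [execs, Op.exec, Store.setNat] using hI₂
          · intro i s₄ hi hf₄ hx₄ hI₄
            have hC₄ := hC₃.frame hf₄ (by rfl)
            have g9 := hf₄.nat 9 (by rfl)
            have g10 := hf₄.nat 10 (by rfl)
            simp [execs, Op.exec, h9, hC₂.nat4] at g9 g10
            refine (entryProgram_spec hv hC₄ g9 g10 hx₄ (by omega) fun c' hc' =>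
              hI₄.1.leftEnd_le hv j le_rfl c' (by omega)).mono le_rfl ?_
            rintro s₅ - ⟨x, b, he, hX, hB⟩
            simp only [Store.setNat, hX, hB]
            rw [← Nat.succ_mul]
            exact hI₄.update (by omega) he
          · rintro s₄ hf₄ ⟨-, hI₄⟩
            have g10 := hf₄.nat 10 (by rfl)
            simp [execs, Op.exec, h9, hC₂.nat4] at g10
            apply Ends.of_ops
            refine ⟨?_, ?_⟩
            · simpa [execs, Op.exec, Store.setNat] using hI₄.next
            · simp [execs, Op.exec, Store.setNat, g10, Nat.succ_mul]
        · simp only [add_assoc, Nat.reduceAdd, List.length_cons, List.length_nil]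
          omega
  · simp; ring_nf; omega

end VoronoiGame

namespace VoronoiGame

open RealRAM

/-! ### Searching for the best threshold and budget -/

/-- Writes the points recorded along the predecessors of the index in register `13`. -/
def extractProgram : Program :=
  forLoop 3 24 1 <| ops [.natLoad 13 0 13, .realLoad 4 2 13, .realStore 1 24 4]

theorem extractProgram_spec {s : Store} {v : ℕ → ℝ} {n k l t : ℕ} (h : Context v n k l t s) :
    Ends extractProgram (k * 6 + 2)
      (fun s' => outputStrategy k s' = tracedSet (s.realMem 2) (s.natMem 0) k (s.nat 13)) s := by
  refine (Ends.forLoop (N := k) (T := 4)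
    (fun i s' => s'.nat 13 = (s.natMem 0)^[i] (s.nat 13) ∧
      ∀ j < i, s'.realMem 1 j = s.realMem 2 ((s.natMem 0)^[j + 1] (s.nat 13)))
    (by decide) (by decide) (by rfl) (by rfl) (by rfl) h.nat1 h.nat3 ?_ ?_).mono le_rfl ?_
  · simp [Store.setNat]
  · rintro i s₁ hi hf hx ⟨h13, hI⟩
    have g0 := hf.natMem 0 (by rfl)
    have g2 := hf.realMem 2 (by rfl)
    apply Ends.of_ops
    have e : (s.natMem 0)^[i + 1] (s.nat 13) = s.natMem 0 ((s.natMem 0)^[i] (s.nat 13)) :=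
      Function.iterate_succ_apply' _ _ _
    refine ⟨by simp [execs, Op.exec, Store.setNat, h13, g0, e], fun j hj => ?_⟩
    rcases Nat.lt_succ_iff_lt_or_eq.1 hj with hj | rfl
    · simpa [execs, Op.exec, Store.setNat, hx, hj.ne] using hI j hj
    · simp [execs, Op.exec, Store.setNat, hx, h13, g0, g2, e]
  · rintro s' - ⟨-, -, hI⟩
    exact Finset.image_congr fun i hi => hI i (by simpa using hi)

/-- With threshold `t` and budget `c` all voters can be passed. -/
def Reaches (v : ℕ → ℝ) (n k t c : ℕ) : Prop :=
  ∀ X B, IsTable v n t (k + 1) X B → rightEnd v n ≤ X ((k + 1) * (n + 1) + c)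

/-- `b` is at most the loss for all pairs of a threshold and a budget up to `(t, i)`. -/
def IsLowerBound (v : ℕ → ℝ) (n k l t i b : ℕ) : Prop :=
  ∀ t' c, c ≤ n → (t' < t ∨ t' = t ∧ c < i) → Reaches v n k t' c → b ≤ l * t' + c

/-- `P` loses at most `b` voters, unless `b` is the initial value. -/
def IsCandidate (v : ℕ → ℝ) (n k l b : ℕ) (P : Finset ℝ) : Prop :=
  b = n + 1 ∨ P.card = k ∧ ∀ Q : Finset ℝ, Q.card = l → (lost v n P Q).card ≤ b

/-- By `exists_budget`, every strategy has a reply that costs it at least l t + c for a reaching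
pair (t, c) in the searched range, hence at least `b`. -/
theorem IsCandidate.isOptimal {v : ℕ → ℝ} {n k l b : ℕ} {P : Finset ℝ} (hv : SortedBelow v n)
    (hk : 1 ≤ k) (h : IsCandidate v n k l b P) (hb : IsLowerBound v n k l (n + 1) 0 b) :
    IsOptimal v n k l b P := by
  have key : ∀ P' : Finset ℝ, P'.card = k → ∃ Q : Finset ℝ, Q.card = l ∧
      b ≤ (lost v n P' Q).card := by
    intro P' hP'
    obtain ⟨t, ht, c, hc, ⟨Q, hQ, hle⟩, hr⟩ := exists_budget (l := l) hv hk hP'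
    exact ⟨Q, hQ, (hb t c hc (Or.inl (by omega)) hr).trans hle⟩
  -- The initial value cannot survive: some strategy loses at least `b` voters, and there are only
  -- n.
  have hne : b ≠ n + 1 := by
    obtain ⟨P', hP'⟩ := Infinite.exists_subset_card_eq ℝ k
    obtain ⟨Q, -, hQ⟩ := key P' hP'
    have := card_won_add_card_lost v n P' Q
    omega
  obtain ⟨h1, h2⟩ := h.resolve_left hne
  exact ⟨h1, h2, key⟩

/-- Compares the losses for all budgets with the best loss found, which is in register `6`. -/
def harvestProgram : Program :=
  forLoop 3 12 4 <|
    .seq (ops [.natAdd 13 9 12, .realLoad 4 2 13, .natAdd 23 7 12]) <|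
    .branch (.realLe 1 4)
      (.branch (.natLt 23 6) (.seq (ops [.natCopy 6 23]) extractProgram) .skip) .skip

theorem harvestProgram_spec {s : Store} {v : ℕ → ℝ} {n k l t : ℕ} (hv : SortedBelow v n)
    (hk : 1 ≤ k) (hl : 1 ≤ l) (h : Context v n k l t s) (h7 : s.nat 7 = l * t)
    (h9 : s.nat 9 = (k + 1) * (n + 1))
    (hT : IsTable v n t (k + 1) (s.realMem 2) (s.natMem 0))
    (hC : IsCandidate v n k l (s.nat 6) (outputStrategy k s))
    (hL : IsLowerBound v n k l t 0 (s.nat 6)) :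
    Ends harvestProgram ((n + 1) * (k * 6 + 30) + 2) (fun s' =>
      IsCandidate v n k l (s'.nat 6) (outputStrategy k s') ∧
        IsLowerBound v n k l (t + 1) 0 (s'.nat 6)) s := by
  refine (Ends.forLoop (N := n + 1) (T := k * 6 + 28)
    (fun i s' => IsCandidate v n k l (s'.nat 6) (outputStrategy k s') ∧
      IsLowerBound v n k l t i (s'.nat 6))
    (by decide) (by decide) (by rfl) (by rfl) (by rfl) h.nat4 h.nat3 ?_ ?_).mono le_rfl ?_
  · exact ⟨by simpa [Store.setNat, outputStrategy] using hC, by simpa [Store.setNat] using hL⟩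
  · rintro i s₁ hi hf hx ⟨hC₁, hL₁⟩
    have hctx := h.frame hf (by rfl)
    have g7 := (hf.nat 7 (by rfl)).trans h7
    have g9 := (hf.nat 9 (by rfl)).trans h9
    have g0 := hf.natMem 0 (by rfl)
    have g2 := hf.realMem 2 (by rfl)
    have skip : ∀ s₂ : Store, s₂.nat 6 = s₁.nat 6 → outputStrategy k s₂ = outputStrategy k s₁ →
        (Reaches v n k t i → s₁.nat 6 ≤ l * t + i) →
        Ends .skip 1 (fun s' => IsCandidate v n k l ((s'.setNat 12 (i + 1)).nat 6)
          (outputStrategy k (s'.setNat 12 (i + 1))) ∧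
          IsLowerBound v n k l t (i + 1) ((s'.setNat 12 (i + 1)).nat 6)) s₂ := by
      intro s₂ k6 kP hR
      have e : (s₂.setNat 12 (i + 1)).nat 6 = s₁.nat 6 := by simpa [Store.setNat] using k6
      refine .of_skip ?_
      rw [e]
      refine ⟨by rw [← kP] at hC₁; exact hC₁, fun t' c hc htc hr => ?_⟩
      by_cases hci : t' = t ∧ c = i
      · obtain ⟨rfl, rfl⟩ := hci
        exact hR hr
      · exact hL₁ t' c hc (by omega) hr
    apply Ends.le
    · apply Ends.ops_seq
      have hctx' := hctx.frame (frame_ops [.natAdd 13 9 12, .realLoad 4 2 13, .natAdd 23 7 12] s₁)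
        (by rfl)
      apply Ends.branch
      · intro hb
        simp [Test.holds, execs, Op.exec, g9, hx, g2, hctx.real1] at hb
        apply Ends.branch
        · intro hc
          simp [Test.holds, execs, Op.exec, g7, hx] at hc
          apply Ends.ops_seq
          refine (extractProgram_spec (hctx'.frame (frame_ops [.natCopy 6 23] _) (by rfl))).mono
            le_rfl ?_
          intro s₂ hf₂ h₂
          have k6 := hf₂.nat 6 (by rfl)
          simp [execs, Op.exec, g7, g9, g2, g0, hx] at k6 h₂
          have e : (s₂.setNat 12 (i + 1)).nat 6 = l * t + i := by simpa [Store.setNat] using k6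
          rw [e]
          obtain ⟨h3, h4⟩ := hT.tracedSet_spec (l := l) hv hk (by omega) hb
          refine ⟨Or.inr ?_, fun t' c hc' htc hr => ?_⟩
          · change (outputStrategy k s₂).card = k ∧
              ∀ Q : Finset ℝ, Q.card = l → (lost v n (outputStrategy k s₂) Q).card ≤ _
            rw [h₂]
            exact ⟨h3, fun Q hQ => h4 Q hQ hl⟩
          · by_cases hci : t' = t ∧ c = i
            · obtain ⟨rfl, rfl⟩ := hci
              exact le_rfl
            · exact hc.le.trans (hL₁ t' c hc' (by omega) hr)
        · intro hc
          simp [Test.holds, execs, Op.exec, g7, hx] at hc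
          exact skip _ (by simp [execs, Op.exec]) rfl fun _ => hc
      · intro hb
        simp [Test.holds, execs, Op.exec, g9, hx, g2, hctx.real1] at hb
        exact skip _ (by simp [execs, Op.exec]) rfl fun hr => absurd (hr _ _ hT) (not_le.2 hb)
    · simp; omega
  · rintro s' - ⟨-, hC', hL'⟩
    exact ⟨hC', fun t' c hc htc hr => hL' t' c hc (by omega) hr⟩

/-- Tries all thresholds. -/
def searchProgram : Program :=
  forLoop 3 8 4 <| .seq tableProgram <| .seq harvestProgram <| ops [.natAdd 7 7 2]

theorem Context.setNat {s : Store} {v : ℕ → ℝ} {n k l t : ℕ} (h : Context v n k l t s) (t' : ℕ) :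
    Context v n k l t' (s.setNat 8 t') := by
  constructor <;> simp [Store.setNat, h.nat0, h.nat1, h.nat2, h.nat3, h.nat4, h.nat5, h.real0,
    h.real1, h.mem0]

theorem searchProgram_spec {s : Store} {v : ℕ → ℝ} {n k l : ℕ} (hv : SortedBelow v n)
    (hk : 1 ≤ k) (hl : 1 ≤ l) (h : Context v n k l 0 s) (h6 : s.nat 6 = n + 1)
    (h7 : s.nat 7 = 0) :
    Ends searchProgram ((n + 1) * ((k + 1) * ((n + 1) * ((n + 1) * (n * 60 + 100) + 22) + 20) +
      (n + 1) * 10 + 20 + ((n + 1) * (k * 6 + 30) + 2) + 2 + 2) + 2)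
      (fun s' => IsOptimal v n k l (s'.nat 6) (outputStrategy k s')) s := by
  -- The loop counter, register 8, is itself the threshold, so `Context` belongs to the invariant
  -- instead of being framed.
  refine (Ends.forLoop (N := n + 1)
    (fun t s' => Context v n k l t s' ∧ s'.nat 7 = l * t ∧
      IsCandidate v n k l (s'.nat 6) (outputStrategy k s') ∧
        IsLowerBound v n k l t 0 (s'.nat 6))
    (by decide) (by decide) (by rfl) (by rfl) (by rfl) h.nat4 h.nat3 ?_ ?_).mono le_rfl ?_
  · refine ⟨h.setNat 0, by simpa [Store.setNat] using h7,
      Or.inl (by simpa [Store.setNat] using h6), fun t' c _ htc => by omega⟩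
  · rintro t s₁ ht hf - ⟨hctx, h7₁, hC, hL⟩
    rw [add_assoc]
    refine Ends.seq_of (tableProgram_spec hv hctx) ?_
    rintro s₂ hf₂ ⟨hT, h9⟩
    have hctx₂ := hctx.frame hf₂ (by rfl)
    have k6 := hf₂.nat 6 (by rfl)
    have k7 := (hf₂.nat 7 (by rfl)).trans h7₁
    have kP : outputStrategy k s₂ = outputStrategy k s₁ := by
      rw [outputStrategy, outputStrategy, hf₂.realMem 1 (by rfl)]
    refine Ends.seq_of (harvestProgram_spec hv hk hl hctx₂ k7 h9 hT (by rwa [k6, kP])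
      (by rwa [k6])) ?_
    rintro s₃ hf₃ ⟨hC₃, hL₃⟩
    have hctx₃ := hctx₂.frame hf₃ (by rfl)
    have m7 := (hf₃.nat 7 (by rfl)).trans k7
    apply Ends.of_ops
    refine ⟨(hctx₃.frame (frame_ops [.natAdd 7 7 2] s₃) (by rfl)).setNat _, ?_, ?_, ?_⟩
    · simp [execs, Op.exec, Store.setNat, m7, hctx₃.nat2, Nat.mul_succ]
    · simpa [execs, Op.exec, Store.setNat, outputStrategy] using hC₃
    · simpa [execs, Op.exec, Store.setNat] using hL₃
  · rintro s' - ⟨-, -, -, hC, hL⟩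
    exact hC.isOptimal hv hk hL

/-! ### Sorting the voters -/

/-- Sorts the first cells of real array `0`; their number is in register `0`. -/
def sortProgram : Program :=
  forLoop 3 8 0 <| forLoop 3 11 8 <|
    .seq (ops [.realLoad 4 0 8, .realLoad 5 0 11]) <|
    .branch (.realLt 4 5) (ops [.realStore 0 11 4, .realStore 0 8 5]) .skip

theorem map_range_comp_swap (a : ℕ → ℝ) {n i j : ℕ} (hi : i < n) (hj : j < n) :
    (Multiset.range n).map (a ∘ Equiv.swap i j) = (Multiset.range n).map a := by
  rw [← Multiset.map_map]
  congr 1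
  refine (Multiset.Nodup.ext ((Multiset.nodup_range n).map (Equiv.swap i j).injective)
    (Multiset.nodup_range n)).2 fun x => ?_
  have key : ∀ y < n, Equiv.swap i j y < n := by
    intro y hy
    rw [Equiv.swap_apply_def]
    split_ifs <;> assumption
  simp only [Multiset.mem_map, Multiset.mem_range]
  exact ⟨fun ⟨y, hy, e⟩ => e ▸ key y hy, fun hx => ⟨_, key x hx, Equiv.swap_apply_self i j x⟩⟩

/-- In round i the first i cells are sorted, and cell i is exchanged with each larger cell in turn.
It always holds an upper bound of the cells already visited, so i + 1 cells are sorted at the end of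
the round. -/
theorem sortProgram_spec {s : Store} {n : ℕ} (h0 : s.nat 0 = n) (h3 : s.nat 3 = 1) :
    Ends sortProgram (n * (n * 10 + 4) + 2) (fun s' => SortedBelow (s'.realMem 0) n ∧
      (Multiset.range n).map (s'.realMem 0) = (Multiset.range n).map (s.realMem 0)) s := by
  refine (Ends.forLoop (N := n) (T := n * 10 + 2) (fun i s' => SortedBelow (s'.realMem 0) i ∧
      (Multiset.range n).map (s'.realMem 0) = (Multiset.range n).map (s.realMem 0))
    (by decide) (by decide) (by rfl) (by rfl) (by rfl) h0 h3 ?_ ?_).mono le_rfl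
    fun s' _ h => h.2
  · exact ⟨fun _ _ _ h => by omega, rfl⟩
  · rintro i s₁ hi hf h8 ⟨hS, hM⟩
    have h3' := (hf.nat 3 (by rfl)).trans h3
    refine (Ends.forLoop (N := i) (T := 8) (fun j s' => SortedBelow (s'.realMem 0) i ∧
      (∀ j' < j, s'.realMem 0 j' ≤ s'.realMem 0 i) ∧
      (Multiset.range n).map (s'.realMem 0) = (Multiset.range n).map (s.realMem 0))
      (by decide) (by decide) (by rfl) (by rfl) (by rfl) h8 h3' ?_ ?_).mono (by omega) ?_
    · exact ⟨hS, by simp, hM⟩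
    · rintro j s₂ hj hf₂ h11 ⟨hS₂, hI₂, hM₂⟩
      have h8₂ := (hf₂.nat 8 (by rfl)).trans h8
      apply Ends.le
      · apply Ends.ops_seq
        apply Ends.branch
        · intro hb
          simp [Test.holds, execs, Op.exec, h8₂, h11] at hb
          apply Ends.of_ops
          have e : ((execs [.realStore 0 11 4, .realStore 0 8 5]
              (execs [.realLoad 4 0 8, .realLoad 5 0 11] s₂)).setNat 11 (j + 1)).realMem 0 =
              s₂.realMem 0 ∘ Equiv.swap i j := by
            simp [execs, Op.exec, h8₂, h11, Store.setNat]
            funext x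
            simp only [Function.update_apply, Function.comp, Equiv.swap_apply_def]
            split_ifs <;> rfl
          rw [e]
          have hsw : ∀ x, x ≠ i → x ≠ j → Equiv.swap i j x = x := fun x h1 h2 =>
            Equiv.swap_apply_of_ne_of_ne h1 h2
          refine ⟨fun p q hpq hq => ?_, fun j' hj' => ?_, ?_⟩
          · simp only [Function.comp]
            rcases eq_or_ne p j with hp | hp <;> rcases eq_or_ne q j with hqj | hqj
            · rw [hp, hqj]
            · rw [hp, Equiv.swap_apply_right, hsw q hq.ne hqj]
              exact hb.le.trans (hS₂ j q (hp ▸ hpq) hq)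
            · rw [hqj, Equiv.swap_apply_right, hsw p (by omega) hp]
              exact hI₂ p (by omega)
            · rw [hsw q hq.ne hqj, hsw p (by omega) hp]
              exact hS₂ p q hpq hq
          · simp only [Function.comp, Equiv.swap_apply_left]
            rcases eq_or_ne j' j with rfl | hne
            · rw [Equiv.swap_apply_right]
              exact hb.le
            · rw [hsw j' (by omega) hne]
              exact hS₂ j' j (by omega) hj
          · rw [map_range_comp_swap _ hi (by omega), hM₂]
        · intro hb
          simp [Test.holds, execs, Op.exec, h8₂, h11] at hb
          apply Ends.of_skip
          refine ⟨hS₂, fun j' hj' => ?_, hM₂⟩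
          rcases Nat.lt_succ_iff_lt_or_eq.1 hj' with hj' | rfl
          · exact hI₂ j' hj'
          · exact hb
      · simp
    · rintro s₂ - ⟨-, hS₂, hI₂, hM₂⟩
      refine ⟨fun p q hpq hq => ?_, hM₂⟩
      rcases Nat.lt_succ_iff_lt_or_eq.1 hq with hq | rfl
      · exact hS₂ p q hpq hq
      · rcases hpq.lt_or_eq with hpq | rfl
        · exact hI₂ p hpq
        · exact le_rfl

/-! ### The whole algorithm -/

/-- Sets up the registers that `Context` refers to. -/
def setupProgram : Program :=
  ops [.natAdd 4 0 3, .natAdd 5 1 3, .natCopy 6 4, .natConst 7 0, .natConst 8 0, .natSub 25 0 3,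
    .natConst 26 0, .realLoad 4 0 25, .realLoad 5 0 26, .realSub 6 4 5, .realConst 7 1,
    .realSub 0 5 6, .realSub 0 0 6, .realSub 0 0 7, .realAdd 1 4 6, .realAdd 1 1 6, .realAdd 1 1 7]

/-- Computes the value and the answer from the smallest loss, which is in register `6`. -/
def answerProgram : Program :=
  .seq (ops [.natCopy 26 0, .natSub 0 0 6, .natAdd 25 0 0]) <|
  .branch (.natLe 26 25) (ops [.natConst 1 1]) (ops [.natConst 1 0])

/-- Computes the value of the game, an optimal strategy, and whether it is a winning strategy. -/
def voronoiProgram : Program :=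
  .seq (ops [.natConst 3 1]) <| .seq sortProgram <| .seq setupProgram <|
  .seq searchProgram answerProgram

theorem map_range_getD (V : List ℝ) :
    (Multiset.range V.length).map (fun i => V.getD i 0) = (V : Multiset ℝ) := by
  rw [Multiset.range, Multiset.map_coe]
  congr 1
  refine List.ext_getElem (by simp) fun i h1 h2 => ?_
  simp [List.getElem?_eq_getElem h2]

theorem time_le {n k : ℕ} (hn : 1 ≤ n) (hk : 1 ≤ k) :
    2 + ((n * (n * 10 + 4) + 2) + (18 + (((n + 1) * ((k + 1) *
      ((n + 1) * ((n + 1) * (n * 60 + 100) + 22) + 20) +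
      (n + 1) * 10 + 20 + ((n + 1) * (k * 6 + 30) + 2) + 2 + 2) + 2) + 9))) ≤
      10000 * (k * n ^ 4) := by
  -- Shifting n and k by one turns both sides into polynomials with natural coefficients that can be
  -- compared monomial by monomial.
  obtain ⟨n, rfl⟩ := Nat.exists_eq_add_of_le' hn
  obtain ⟨k, rfl⟩ := Nat.exists_eq_add_of_le' hk
  ring_nf
  omega

theorem voronoiProgram_spec {V : List ℝ} {k l : ℕ} (hV : V ≠ []) (hk : 1 ≤ k) (hl : 1 ≤ l) :
    Ends voronoiProgram (10000 * (k * V.length ^ 4)) (fun s => ∃ v b,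
      (Multiset.range V.length).map v = (V : Multiset ℝ) ∧
      IsOptimal v V.length k l b (outputStrategy k s) ∧ outputValue s = V.length - b ∧
      outputAnswer s = if V.length ≤ (V.length - b) + (V.length - b) then 1 else 0)
      (input V k l) := by
  have hn : 1 ≤ V.length := List.length_pos_iff.2 hV
  refine Ends.le ?_ (time_le hn hk)
  set n := V.length
  apply Ends.ops_seq
  refine Ends.seq_of (sortProgram_spec (n := n) (by simp [execs, Op.exec, input, n])
    (by simp [execs, Op.exec])) ?_
  rintro s₁ hf₁ ⟨hS, hM⟩
  have g0 := hf₁.nat 0 (by rfl)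
  have g1 := hf₁.nat 1 (by rfl)
  have g2 := hf₁.nat 2 (by rfl)
  have g3 := hf₁.nat 3 (by rfl)
  simp [execs, Op.exec, input] at g0 g1 g2 g3
  set v := s₁.realMem 0
  have hv : (Multiset.range n).map v = (V : Multiset ℝ) := by
    rw [hM, ← map_range_getD V]
    simp [execs, Op.exec, input, n]
  apply Ends.ops_seq (T := _ + 9)
  refine Ends.seq_of (searchProgram_spec (v := v) (n := n) (k := k) (l := l) hS hk hl ?_ ?_ ?_) ?_
  · constructor <;> simp [execs, Op.exec, g0, g1, g2, g3, leftEnd, rightEnd, v, n]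
  · simp [execs, Op.exec, g0, g3, n]
  · simp [execs, Op.exec]
  · intro s₂ hf₂ hO
    have k0 := hf₂.nat 0 (by rfl)
    simp [execs, Op.exec, g0] at k0
    apply Ends.ops_seq (T := 5)
    apply Ends.branch (T₁ := 2) (T₂ := 2)
    · intro hb
      simp [Test.holds, execs, Op.exec, k0] at hb
      apply Ends.of_ops
      refine ⟨v, s₂.nat 6, hv, hO, ?_, ?_⟩
      · simp [outputValue, execs, Op.exec, k0, n]
      · simp [outputAnswer, execs, Op.exec, n, hb]
    · intro hb
      simp [Test.holds, execs, Op.exec, k0] at hb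
      apply Ends.of_ops
      refine ⟨v, s₂.nat 6, hv, hO, ?_, ?_⟩
      · simp [outputValue, execs, Op.exec, k0, n]
      · simp [outputAnswer, execs, Op.exec, n, hb]

end VoronoiGame

/-- One real RAM program computes, for every nonempty multiset `V` of voters on the line (given as a
list in any order) and all `k, ℓ ≥ 1`, the value `Γ_{k,ℓ}(V)`, a set of `k` points that realizes it,
and whether the first player has a winning strategy, in at most `C * (k * n ^ 4)` steps. -/
theorem mainTheorem1 :
    ∃ (p : RealRAM.Program) (C : ℕ), ∀ (V : List ℝ) (k l : ℕ), V ≠ [] → 1 ≤ k → 1 ≤ l →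
      ∃ (t : ℕ) (s : RealRAM.Store),
        RealRAM.Runs p (VoronoiGame.input V k l) t s ∧
        t ≤ C * (k * V.length ^ 4) ∧
        VoronoiGame.outputValue s = VoronoiGame.Gam k l (V : Multiset ℝ) ∧
        (VoronoiGame.outputStrategy k s).card = k ∧
        VoronoiGame.Realizes (V : Multiset ℝ) l (VoronoiGame.outputStrategy k s)
          (VoronoiGame.Gam k l (V : Multiset ℝ)) ∧
        (VoronoiGame.HasWinningStrategy (V : Multiset ℝ) k l → VoronoiGame.outputAnswer s = 1) ∧
        (¬ VoronoiGame.HasWinningStrategy (V : Multiset ℝ) k l →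
          VoronoiGame.outputAnswer s = 0) := by
  refine ⟨VoronoiGame.voronoiProgram, 10000, fun V k l hV hk hl => ?_⟩
  obtain ⟨t, s, hr, ht, v, b, hv, hO, hval, hans⟩ := VoronoiGame.voronoiProgram_spec hV hk hl
  refine ⟨t, s, hr, ht, ?_⟩
  rw [← hv, hO.gam_eq, hO.hasWinningStrategy_iff, hval, hans]
  exact ⟨rfl, hO.1, hO.realizes, fun h => if_pos h, fun h => if_neg h⟩
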